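/- Let $A$ be a simple $\sigma$-unital $C^*$-algebra (simple: $A\neq 0$ and $A$ has no closed two-sided ideals other than $0$ and $A$; $\sigma$-unital: $A$ has a countable approximate unit). A trace on $A$ is an additive, positively homogeneous map $\sigma\colon A_+\to[0,\infty]$ with $\sigma(0)=0$ and $\sigma(a^*a)=\sigma(aa^*)$ for all $a\in A$; it is densely defined if the linear span of $\{a\in A_+ : \sigma(a)<\infty\}$ is dense in $A$. Let $\tau$ be a nonzero densely defined lower semicontinuous trace on $A$, and assume that it is unique up to scalar multiples, i.e. every densely defined lower semicontinuous trace on $A$ is of the form $c\tau$ with $c\in[0,\infty)$. Let $\mathbb K$ be the compact operators on a separable infinite-dimensional Hilbert space. Write $\hat\tau=\tau\otimes\mathrm{Tr}$ for the induced trace on $(A\otimes\mathbb K)_+$, that is, $\hat\tau(x)=\sum_{i}\tau(x_{ii})$ for $x=(x_{ij})_{i,j}$, and let $d_\tau(h)=\lim_{n\to\infty}\hat\tau(h^{1/n})\in[0,\infty]$ for $h\in(A\otimes\mathbb K)_+$. Put $$\mathcal F(A)=\left\{\frac{d_\tau(h_1)}{d_\tau(h_2)} \;:\; h_1,h_2\in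 (A\otimes\mathbb K)_+\setminus\{0\},\ \overline{h_1(A\otimes\mathbb K)h_1}\cong\overline{h_2(A\otimes\mathbb K)h_2},\ d_\tau(h_2)<\infty\right\},$$ where $\cong$ denotes $*$-isomorphism. Then $\mathcal F(A)$ is a subgroup of the multiplicative group $\mathbb R_+^\times=(0,\infty)$; in particular every ratio occurring in $\mathcal F(A)$ is a positive real number. -/

import Mathlib

open Filter Topology UniformSpace
open scoped ENNReal NNReal

noncomputable section

namespace FundGroup

universe u

/-! ### The stabilization `A ⊗ 𝕂`

`A ⊗ 𝕂` is built as the C⋆-inductive limit of the matrix algebras `M_n(A)` along the upper left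
corner embeddings `a ↦ diag(a, 0)`: the algebraic direct limit carries the (unique) C⋆-norm of the
matrix algebras, and `A ⊗ 𝕂` is its completion. -/

section Construction

variable (A : Type u) [NonUnitalCStarAlgebra A]

/-- The C⋆-algebra `M_n(A)`. -/
abbrev Mat (n : ℕ) : Type u := CStarMatrix (Fin n) (Fin n) A

variable {A}

/-- The matrix `diag(M, 0) ∈ M_n(A)` for `M ∈ M_m(A)`, `m ≤ n`. -/
def padFun (m n : ℕ) (M : Mat A m) : Mat A n :=
  CStarMatrix.ofMatrix fun i j =>
    if hi : (i : ℕ) < m then if hj : (j : ℕ) < m then M ⟨i, hi⟩ ⟨j, hj⟩ else 0 else 0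

lemma padFun_apply (m n : ℕ) (M : Mat A m) (i j : Fin n) :
    padFun m n M i j =
      if hi : (i : ℕ) < m then if hj : (j : ℕ) < m then M ⟨i, hi⟩ ⟨j, hj⟩ else 0 else 0 := rfl

/-- The upper left corner embedding `M_m(A) → M_n(A)`, `m ≤ n`. -/
def pad (m n : ℕ) (h : m ≤ n) : Mat A m →⋆ₙₐ[ℂ] Mat A n where
  toFun := padFun m n
  map_smul' c M := by
    ext i j
    rw [MonoidHom.id_apply, CStarMatrix.smul_apply]
    simp only [padFun_apply, CStarMatrix.smul_apply]
    split_ifs <;> simp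
  map_zero' := by
    ext i j
    simp [padFun_apply]
  map_add' M N := by
    ext i j
    rw [CStarMatrix.add_apply]
    simp only [padFun_apply, CStarMatrix.add_apply]
    split_ifs <;> simp
  map_mul' M N := by
    ext i j
    rw [CStarMatrix.mul_apply]
    simp only [padFun_apply]
    by_cases hi : (i : ℕ) < m
    · by_cases hj : (j : ℕ) < m
      · simp only [hi, hj, dif_pos, CStarMatrix.mul_apply]
        rw [← Finset.sum_subset (Finset.subset_univ (Finset.univ.map (Fin.castLEEmb h)))]
        · rw [Finset.sum_map]
          exact Finset.sum_congr rfl fun k _ => by simp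
        · intro k _ hk
          have : ¬ (k : ℕ) < m := fun hlt => hk (by
            simp only [Finset.mem_map, Finset.mem_univ, true_and]
            exact ⟨⟨k, hlt⟩, by ext; simp⟩)
          simp [this]
      · simp [hj]
    · simp [hi]
  map_star' M := by
    ext i j
    rw [CStarMatrix.star_apply]
    simp only [padFun_apply, CStarMatrix.star_apply]
    split_ifs <;> simp

lemma pad_apply (m n : ℕ) (h : m ≤ n) (M : Mat A m) (i j : Fin n) :
    pad m n h M i j =
      if hi : (i : ℕ) < m then if hj : (j : ℕ) < m then M ⟨i, hi⟩ ⟨j, hj⟩ else 0 else 0 := rfl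

lemma pad_injective (m n : ℕ) (h : m ≤ n) : Function.Injective (pad (A := A) m n h) := by
  intro M N hMN
  ext i j
  have := congrFun (congrFun hMN ⟨i, i.2.trans_le h⟩) ⟨j, j.2.trans_le h⟩
  simpa [pad_apply] using this

instance pad_directedSystem :
    DirectedSystem (fun n => Mat A n) (fun m n h => ⇑(pad (A := A) m n h)) where
  map_self n M := by ext i j; simp [pad_apply]
  map_map k j i hij hjk M := by
    ext p q
    simp only [pad_apply]
    by_cases hp : (p : ℕ) < i
    · by_cases hq : (q : ℕ) < i
      · simp [hp, hq, hp.trans_le hij, hq.trans_le hij]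
      · simp [hp, hq]
    · simp [hp]

variable (A)

/-- The algebraic direct limit `M_∞(A) = ⋃ M_n(A)`. -/
def MInf : Type u := DirectLimit (fun n => Mat A n) (fun m n h => pad (A := A) m n h)

instance : NonUnitalRing (MInf A) :=
  inferInstanceAs (NonUnitalRing (DirectLimit (fun n => Mat A n) (fun m n h => pad m n h)))

instance : Module ℂ (MInf A) :=
  inferInstanceAs (Module ℂ (DirectLimit (fun n => Mat A n) (fun m n h => pad m n h)))

instance : StarRing (MInf A) where
  toStarMul := inferInstanceAs
    (StarMul (DirectLimit (fun n => Mat A n) (fun m n h => pad m n h)))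
  star_add := (inferInstance :
    StarAddMonoid (DirectLimit (fun n => Mat A n) (fun m n h => pad m n h))).star_add

instance : StarModule ℂ (MInf A) :=
  inferInstanceAs (StarModule ℂ (DirectLimit (fun n => Mat A n) (fun m n h => pad m n h)))

variable {A}

/-- The canonical embedding `M_n(A) → M_∞(A)`. -/
def ofMat (n : ℕ) : Mat A n →⋆ₙₐ[ℂ] MInf A where
  toFun M := (⟦⟨n, M⟩⟧ : DirectLimit (fun n => Mat A n) (fun m n h => pad m n h))
  map_smul' _ _ := rfl
  map_zero' := (DirectLimit.zero_def (f := fun m n h => pad (A := A) m n h) n).symm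
  map_add' _ _ := (DirectLimit.add_def (f := fun m n h => pad (A := A) m n h) ..).symm
  map_mul' _ _ := (DirectLimit.mul_def (f := fun m n h => pad (A := A) m n h) ..).symm
  map_star' _ := rfl

lemma ofMat_pad (m n : ℕ) (h : m ≤ n) (M : Mat A m) : ofMat n (pad m n h M) = ofMat m M :=
  DirectLimit.mk_apply (f := fun m n h => pad (A := A) m n h) m n M h

lemma MInf.exists₁ (x : MInf A) : ∃ n M, x = ofMat n M :=
  DirectLimit.exists_eq_mk (fun m n h => pad (A := A) m n h) x

lemma MInf.exists₂ (x y : MInf A) : ∃ n M N, x = ofMat n M ∧ y = ofMat n N :=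
  DirectLimit.exists_eq_mk₂ (fun m n h => pad (A := A) m n h) x y

variable [PartialOrder A] [StarOrderedRing A]

instance : IsScalarTower ℂ (MInf A) (MInf A) where
  smul_assoc c x y := by
    obtain ⟨n, M, N, rfl, rfl⟩ := MInf.exists₂ x y
    simp only [smul_eq_mul, ← map_smul, ← map_mul, smul_mul_assoc]

instance : SMulCommClass ℂ (MInf A) (MInf A) where
  smul_comm c x y := by
    obtain ⟨n, M, N, rfl, rfl⟩ := MInf.exists₂ x y
    simp only [smul_eq_mul, ← map_smul, ← map_mul, mul_smul_comm]

lemma norm_pad (m n : ℕ) (h : m ≤ n) (M : Mat A m) : ‖pad m n h M‖ = ‖M‖ :=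
  NonUnitalStarAlgHom.norm_map (pad m n h) (pad_injective m n h) M

instance : Norm (MInf A) where
  norm x := DirectLimit.lift (fun m n h => pad (A := A) m n h) (fun _ M => ‖M‖)
    (fun m n h M => (norm_pad m n h M).symm) x

lemma norm_ofMat (n : ℕ) (M : Mat A n) : ‖ofMat n M‖ = ‖M‖ := rfl

instance : NormedAddCommGroup (MInf A) :=
  AddGroupNorm.toNormedAddCommGroup
    { toFun := fun x => ‖x‖
      map_zero' := by rw [← map_zero (ofMat (A := A) 0), norm_ofMat, norm_zero]
      add_le' := fun x y => by
        obtain ⟨n, M, N, rfl, rfl⟩ := MInf.exists₂ x y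
        rw [← map_add, norm_ofMat, norm_ofMat, norm_ofMat]
        exact norm_add_le M N
      neg' := fun x => by
        obtain ⟨n, M, rfl⟩ := MInf.exists₁ x
        rw [← map_neg, norm_ofMat, norm_ofMat, norm_neg]
      eq_zero_of_map_eq_zero' := fun x hx => by
        obtain ⟨n, M, rfl⟩ := MInf.exists₁ x
        rw [norm_ofMat, norm_eq_zero] at hx
        rw [hx, map_zero] }

instance : NonUnitalNormedRing (MInf A) where
  __ := (inferInstance : NormedAddCommGroup (MInf A))
  __ := (inferInstance : NonUnitalRing (MInf A))
  norm_mul_le x y := by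
    obtain ⟨n, M, N, rfl, rfl⟩ := MInf.exists₂ x y
    rw [← map_mul, norm_ofMat, norm_ofMat, norm_ofMat]
    exact norm_mul_le M N

instance : NormedSpace ℂ (MInf A) where
  norm_smul_le c x := by
    obtain ⟨n, M, rfl⟩ := MInf.exists₁ x
    rw [← map_smul, norm_ofMat, norm_ofMat]
    exact norm_smul_le c M

instance : CStarRing (MInf A) where
  norm_mul_self_le x := by
    obtain ⟨n, M, rfl⟩ := MInf.exists₁ x
    rw [← map_star, ← map_mul, norm_ofMat, norm_ofMat]
    exact CStarRing.norm_mul_self_le M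

variable (A)

/-- The stabilization `A ⊗ 𝕂`. -/
def Stab : Type u := Completion (MInf A)

namespace Stab

instance instNormedAddCommGroup : NormedAddCommGroup (Stab A) :=
  inferInstanceAs (NormedAddCommGroup (Completion (MInf A)))

instance : NormedSpace ℂ (Stab A) := inferInstanceAs (NormedSpace ℂ (Completion (MInf A)))

instance : CompleteSpace (Stab A) := inferInstanceAs (CompleteSpace (Completion (MInf A)))

variable {A}

/-- The canonical dense embedding `M_∞(A) → A ⊗ 𝕂`. -/
def coe (x : MInf A) : Stab A := (x : Completion (MInf A))

lemma isDenseInducing_coe : IsDenseInducing (coe (A := A)) :=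
  Completion.isDenseInducing_coe

lemma continuous_coe : Continuous (coe (A := A)) := Completion.continuous_coe _

lemma norm_coe (x : MInf A) : ‖coe x‖ = ‖x‖ := Completion.norm_coe x

lemma coe_add (x y : MInf A) : coe (x + y) = coe x + coe y := Completion.coe_add x y

lemma coe_zero : coe (0 : MInf A) = 0 := rfl

lemma coe_smul (c : ℂ) (x : MInf A) : coe (c • x) = c • coe x := Completion.coe_smul c x

lemma ind {p : Stab A → Prop} (x : Stab A) (hp : IsClosed {x | p x}) (h : ∀ a, p (coe a)) : p x :=
  Completion.induction_on x hp h

lemma ind₂ {p : Stab A → Stab A → Prop} (x y : Stab A)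
    (hp : IsClosed {z : Stab A × Stab A | p z.1 z.2}) (h : ∀ a b, p (coe a) (coe b)) : p x y :=
  Completion.induction_on₂ x y hp h

lemma ind₃ {p : Stab A → Stab A → Stab A → Prop} (x y z : Stab A)
    (hp : IsClosed {w : Stab A × Stab A × Stab A | p w.1 w.2.1 w.2.2})
    (h : ∀ a b c, p (coe a) (coe b) (coe c)) : p x y z :=
  Completion.induction_on₃ x y z hp h

/-- The product of `A ⊗ 𝕂` extends that of `M_∞(A)` by continuity. -/
instance : Mul (Stab A) where
  mul := Function.curry ((isDenseInducing_coe.prodMap isDenseInducing_coe).extend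
    (coe ∘ Function.uncurry (· * ·)))

lemma coe_mul (x y : MInf A) : coe (x * y) = coe x * coe y :=
  ((isDenseInducing_coe.prodMap isDenseInducing_coe).extend_eq
    (continuous_coe.comp (continuous_mul (M := MInf A))) (x, y)).symm

instance : ContinuousMul (Stab A) where
  continuous_mul := by
    let m := (AddMonoidHom.mul : MInf A →+ MInf A →+ MInf A).compr₂ Completion.toCompl
    have : Continuous fun p : MInf A × MInf A => m p.1 p.2 :=
      (Completion.continuous_coe (MInf A)).comp continuous_mul
    have di : IsDenseInducing (Completion.toCompl : MInf A → Completion (MInf A)) :=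
      Completion.isDenseInducing_coe
    exact (di.extend_Z_bilin di this :)

/-- The involution of `A ⊗ 𝕂` extends that of `M_∞(A)` by continuity. -/
instance : Star (Stab A) where
  star := Completion.map (star : MInf A → MInf A)

lemma uniformContinuous_star' : UniformContinuous (star : MInf A → MInf A) :=
  (AddMonoidHomClass.isometry_of_norm (starAddEquiv : MInf A ≃+ MInf A)
    fun x => norm_star x).uniformContinuous

lemma coe_star (x : MInf A) : coe (star x) = star (coe x) :=
  (Completion.map_coe uniformContinuous_star' x).symm

lemma continuous_star' : Continuous (star : Stab A → Stab A) := Completion.continuous_map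

lemma mul_add' (a b c : Stab A) : a * (b + c) = a * b + a * c :=
  ind₃ (p := fun a b c => a * (b + c) = a * b + a * c) a b c
    (isClosed_eq (by fun_prop) (by fun_prop)) fun a b c => by
      rw [← coe_add, ← coe_mul, ← coe_mul, ← coe_mul, ← coe_add, mul_add]

lemma add_mul' (a b c : Stab A) : (a + b) * c = a * c + b * c :=
  ind₃ (p := fun a b c => (a + b) * c = a * c + b * c) a b c
    (isClosed_eq (by fun_prop) (by fun_prop)) fun a b c => by
      rw [← coe_add, ← coe_mul, ← coe_mul, ← coe_mul, ← coe_add, add_mul]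

lemma mul_assoc' (a b c : Stab A) : a * b * c = a * (b * c) :=
  ind₃ (p := fun a b c => a * b * c = a * (b * c)) a b c
    (isClosed_eq (by fun_prop) (by fun_prop)) fun a b c => by
      rw [← coe_mul, ← coe_mul, ← coe_mul, ← coe_mul, mul_assoc]

lemma zero_mul' (a : Stab A) : 0 * a = 0 :=
  ind (p := fun a => 0 * a = 0) a (isClosed_eq (by fun_prop) (by fun_prop)) fun a => by
    rw [← coe_zero, ← coe_mul, zero_mul]

lemma mul_zero' (a : Stab A) : a * 0 = 0 :=
  ind (p := fun a => a * 0 = 0) a (isClosed_eq (by fun_prop) (by fun_prop)) fun a => by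
    rw [← coe_zero, ← coe_mul, mul_zero]

lemma norm_mul_le' (a b : Stab A) : ‖a * b‖ ≤ ‖a‖ * ‖b‖ :=
  ind₂ (p := fun a b => ‖a * b‖ ≤ ‖a‖ * ‖b‖) a b
    (isClosed_le (by fun_prop) (by fun_prop)) fun a b => by
      rw [← coe_mul, norm_coe, norm_coe, norm_coe]
      exact norm_mul_le a b

lemma star_star' (a : Stab A) : star (star a) = a :=
  ind (p := fun a => star (star a) = a) a
    (isClosed_eq (continuous_star'.comp continuous_star') continuous_id) fun a => by
      rw [← coe_star, ← coe_star, star_star]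

lemma star_mul' (a b : Stab A) : star (a * b) = star b * star a :=
  ind₂ (p := fun a b => star (a * b) = star b * star a) a b
    (isClosed_eq (continuous_star'.comp (by fun_prop))
      ((continuous_star'.comp continuous_snd).mul (continuous_star'.comp continuous_fst)))
    fun a b => by rw [← coe_mul, ← coe_star, ← coe_star, ← coe_star, ← coe_mul, star_mul]

lemma star_add' (a b : Stab A) : star (a + b) = star a + star b :=
  ind₂ (p := fun a b => star (a + b) = star a + star b) a b
    (isClosed_eq (continuous_star'.comp (by fun_prop))
      ((continuous_star'.comp continuous_fst).add (continuous_star'.comp continuous_snd)))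
    fun a b => by rw [← coe_add, ← coe_star, ← coe_star, ← coe_star, ← coe_add, star_add]

lemma norm_mul_self_le' (a : Stab A) : ‖a‖ * ‖a‖ ≤ ‖star a * a‖ :=
  ind (p := fun a => ‖a‖ * ‖a‖ ≤ ‖star a * a‖) a (isClosed_le (by fun_prop)
    (continuous_norm.comp (continuous_star'.mul continuous_id))) fun a => by
      rw [← coe_star, ← coe_mul, norm_coe, norm_coe]
      exact CStarRing.norm_mul_self_le a

lemma continuous_smul' (c : ℂ) : Continuous fun a : Stab A => c • a := continuous_const_smul c

lemma smul_mul' (c : ℂ) (a b : Stab A) : (c • a) * b = c • (a * b) :=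
  ind₂ (p := fun a b => (c • a) * b = c • (a * b)) a b
    (isClosed_eq (((continuous_smul' c).comp continuous_fst).mul continuous_snd)
      ((continuous_smul' c).comp continuous_mul)) fun a b => by
      rw [← coe_smul, ← coe_mul, ← coe_mul, ← coe_smul, smul_mul_assoc]

lemma mul_smul' (c : ℂ) (a b : Stab A) : a * (c • b) = c • (a * b) :=
  ind₂ (p := fun a b => a * (c • b) = c • (a * b)) a b
    (isClosed_eq (continuous_fst.mul ((continuous_smul' c).comp continuous_snd))
      ((continuous_smul' c).comp continuous_mul)) fun a b => by
      rw [← coe_smul, ← coe_mul, ← coe_mul, ← coe_smul, mul_smul_comm]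

lemma star_smul' (c : ℂ) (a : Stab A) : star (c • a) = star c • star a :=
  ind (p := fun a => star (c • a) = star c • star a) a
    (isClosed_eq (continuous_star'.comp (continuous_smul' c))
      ((continuous_smul' (star c)).comp continuous_star'))
    fun a => by rw [← coe_smul, ← coe_star, ← coe_star, ← coe_smul, star_smul]

instance instNonUnitalNormedRing : NonUnitalNormedRing (Stab A) where
  __ := instNormedAddCommGroup A
  left_distrib := mul_add'
  right_distrib := add_mul'
  zero_mul := zero_mul'
  mul_zero := mul_zero'
  mul_assoc := mul_assoc'
  norm_mul_le := norm_mul_le'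

/-- `A ⊗ 𝕂` is a C⋆-algebra. -/
instance instNonUnitalCStarAlgebra : NonUnitalCStarAlgebra (Stab A) where
  star_involutive := star_star'
  star_mul := star_mul'
  star_add := star_add'
  norm_mul_self_le := norm_mul_self_le'
  smul_assoc := smul_mul'
  smul_comm c a b := (mul_smul' c a b).symm
  star_smul := star_smul'
  norm_smul_le := norm_smul_le

/-- `A ⊗ 𝕂` carries its C⋆-algebra order: `x ≤ y` iff `y - x` is self-adjoint with non-negative
spectrum. -/
instance : PartialOrder (Stab A) := CStarAlgebra.spectralOrder (Stab A)

instance : StarOrderedRing (Stab A) := CStarAlgebra.spectralOrderedRing (Stab A)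

end Stab

/-! ### Matrix entries of elements of `A ⊗ 𝕂` -/

variable {A}

/-- The `(i, j)`-entry of an element of `M_∞(A)`, as a linear map. -/
def entryLin (i j : ℕ) : MInf A →ₗ[ℂ] A :=
  DirectLimit.Module.lift ℂ ℕ (fun n => Mat A n) (fun m n h => pad (A := A) m n h)
    (fun n =>
      { toFun := fun M => if hi : i < n then if hj : j < n then M ⟨i, hi⟩ ⟨j, hj⟩ else 0 else 0
        map_add' := fun M N => by split_ifs <;> simp
        map_smul' := fun c M => by split_ifs <;> simp })
    (fun m n h M => by
      change (if hi : i < n then if hj : j < n then pad m n h M ⟨i, hi⟩ ⟨j, hj⟩ else 0 else 0) =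
        if hi : i < m then if hj : j < m then M ⟨i, hi⟩ ⟨j, hj⟩ else 0 else 0
      simp only [pad_apply]
      by_cases hi : i < m
      · by_cases hj : j < m
        · simp [hi, hj, hi.trans_le h, hj.trans_le h]
        · simp [hj]
      · simp [hi])

lemma entryLin_ofMat (i j n : ℕ) (M : Mat A n) : entryLin i j (ofMat n M) =
    if hi : i < n then if hj : j < n then M ⟨i, hi⟩ ⟨j, hj⟩ else 0 else 0 := rfl

lemma norm_entryLin_le (i j : ℕ) (x : MInf A) : ‖entryLin i j x‖ ≤ 1 * ‖x‖ := by
  obtain ⟨n, M, rfl⟩ := MInf.exists₁ x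
  rw [entryLin_ofMat, norm_ofMat, one_mul]
  split_ifs
  · exact CStarMatrix.norm_entry_le_norm
  · simp
  · simp

/-- The `(i, j)`-entry `x_{ij} ∈ A` of `x ∈ A ⊗ 𝕂`: the continuous extension of the entry map
of `M_∞(A)`. -/
def entry (i j : ℕ) (x : Stab A) : A :=
  Completion.extension (fun y : MInf A => entryLin i j y) x

lemma uniformContinuous_entryLin (i j : ℕ) :
    UniformContinuous (fun y : MInf A => entryLin i j y) :=
  AddMonoidHomClass.uniformContinuous_of_bound (entryLin i j).toAddMonoidHom 1
    (norm_entryLin_le i j)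

lemma entry_coe (i j : ℕ) (x : MInf A) : entry i j (Stab.coe x) = entryLin i j x :=
  Completion.extension_coe (uniformContinuous_entryLin i j) x

lemma continuous_entry (i j : ℕ) : Continuous (entry (A := A) i j) :=
  Completion.continuous_extension

end Construction

/-! ### Simple and `σ`-unital C⋆-algebras -/

section Algebras

variable (A : Type u) [NonUnitalCStarAlgebra A]

/-- A C⋆-algebra is simple if it is nonzero and its only closed two-sided ideals are `0` and
itself. -/
def IsSimple : Prop :=
  Nontrivial A ∧ ∀ I : Submodule ℂ A, IsClosed (I : Set A) →
    (∀ a : A, ∀ x ∈ I, a * x ∈ I ∧ x * a ∈ I) → I = ⊥ ∨ I = ⊤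

/-- A C⋆-algebra is `σ`-unital if it has a countable approximate unit. -/
def IsSigmaUnital [PartialOrder A] : Prop :=
  ∃ e : ℕ → A, (∀ n, 0 ≤ e n ∧ ‖e n‖ ≤ 1) ∧
    ∀ a : A, Tendsto (fun n => e n * a) atTop (𝓝 a) ∧ Tendsto (fun n => a * e n) atTop (𝓝 a)

variable {A}

/-- The hereditary C⋆-subalgebra generated by a positive element `h`, that is, the closure of
`hAh`. -/
def her [PartialOrder A] [StarOrderedRing A] (h : A) (hh : 0 ≤ h) : NonUnitalStarSubalgebra ℂ A :=
  NonUnitalStarSubalgebra.topologicalClosure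
    { carrier := Set.range fun x => h * x * h
      add_mem' := by
        rintro _ _ ⟨x, rfl⟩ ⟨y, rfl⟩
        exact ⟨x + y, by simp only [mul_add, add_mul]⟩
      zero_mem' := ⟨0, by simp⟩
      mul_mem' := by
        rintro _ _ ⟨x, rfl⟩ ⟨y, rfl⟩
        exact ⟨x * h * h * y, by simp only [mul_assoc]⟩
      smul_mem' := by
        rintro c _ ⟨x, rfl⟩
        exact ⟨c • x, by simp only [mul_smul_comm, smul_mul_assoc]⟩
      star_mem' := by
        rintro _ ⟨x, rfl⟩
        exact ⟨star x, by simp only [star_mul, (IsSelfAdjoint.of_nonneg hh).star_eq, mul_assoc]⟩ }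

lemma coe_her [PartialOrder A] [StarOrderedRing A] (h : A) (hh : 0 ≤ h) :
    (her h hh : Set A) = closure (Set.range fun x => h * x * h) :=
  rfl

end Algebras

/-! ### Traces -/

section Traces

variable (A : Type u) [NonUnitalCStarAlgebra A] [PartialOrder A]

/-- A trace on `A`: an additive, positively homogeneous `[0, ∞]`-valued map `τ` on the positive
cone of `A` with `τ 0 = 0` and `τ (a⋆ a) = τ (a a⋆)`. Only the values of `toFun` on positive
elements are meaningful. -/
structure PosTrace where
  /-- The underlying function. -/
  toFun : A → ℝ≥0∞
  map_zero : toFun 0 = 0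
  map_add : ∀ a b : A, 0 ≤ a → 0 ≤ b → toFun (a + b) = toFun a + toFun b
  map_smul : ∀ (c : ℝ≥0) (a : A), 0 ≤ a → toFun (((c : ℝ) : ℂ) • a) = (c : ℝ≥0∞) * toFun a
  map_star_mul_self : ∀ a : A, toFun (star a * a) = toFun (a * star a)

variable {A}

namespace PosTrace

variable (τ : PosTrace A)

/-- `τ` is densely defined if the span of the positive elements of finite trace is dense. -/
def IsDenselyDefined : Prop :=
  Dense (Submodule.span ℂ {a : A | 0 ≤ a ∧ τ.toFun a < ∞} : Set A)

/-- `τ` is lower semicontinuous on the positive cone. -/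
def IsLSC : Prop := LowerSemicontinuousOn τ.toFun {a : A | 0 ≤ a}

/-- `τ` is the unique (up to scalar multiples) densely defined lower semicontinuous trace:
it is a nonzero densely defined lower semicontinuous trace, and every densely defined lower
semicontinuous trace is a scalar multiple of it. -/
def IsUniqueTrace : Prop :=
  τ.IsDenselyDefined ∧ τ.IsLSC ∧ (∃ a : A, 0 ≤ a ∧ τ.toFun a ≠ 0) ∧
    ∀ σ : PosTrace A, σ.IsDenselyDefined → σ.IsLSC →
      ∃ c : ℝ≥0, ∀ a : A, 0 ≤ a → σ.toFun a = (c : ℝ≥0∞) * τ.toFun a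

variable [StarOrderedRing A]

/-- The induced trace `τ̂ = τ ⊗ Tr` on the positive elements `x = (x_{ij})` of `A ⊗ 𝕂`:
`τ̂ x = ∑ τ (x_{ii})`. -/
def hat (x : Stab A) : ℝ≥0∞ := ∑' i : ℕ, τ.toFun (entry i i x)

/-- The dimension function `d_τ h = lim τ̂ (h ^ (1 / n))` for positive `h ∈ A ⊗ 𝕂`. The limit
always exists in `[0, ∞]`, because `(h / ‖h‖) ^ (1 / n)` increases with `n`; it is written as a
limit superior so that no default value is involved. -/
def dim (h : Stab A) : ℝ≥0∞ :=
  limsup (fun n : ℕ => τ.hat (h ^ (1 / ((n : ℝ≥0) + 1)))) atTop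

/-- The set of all ratios `d_τ h₁ / d_τ h₂`, for nonzero positive `h₁, h₂ ∈ A ⊗ 𝕂` such that the
hereditary subalgebras generated by `h₁` and `h₂` are isomorphic and `d_τ h₂ < ∞`. -/
def fundamentalSet : Set ℝ≥0∞ :=
  {t | ∃ (h₁ h₂ : Stab A) (p₁ : 0 ≤ h₁) (p₂ : 0 ≤ h₂), h₁ ≠ 0 ∧ h₂ ≠ 0 ∧
    Nonempty (her h₁ p₁ ≃⋆ₐ[ℂ] her h₂ p₂) ∧ τ.dim h₂ < ∞ ∧ t = τ.dim h₁ / τ.dim h₂}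

end PosTrace

end Traces

end FundGroup

end

-- Write `D` for `A ⊗ 𝕂`. The key fact is that a ⋆-isomorphism `φ : her h₁ → her h₂` multiplies `τ̂`
-- by a constant `c > 0` (`exists_scaling`). The trace `τ̂ ∘ φ` lives only on `her h₁`, so
-- uniqueness of `τ` cannot be applied to it directly; it is first extended to `D`. Since `D` is
-- simple and σ-unital, there are `v i ∈ h₁ D` with `∑ star (v i) * v i = 1` strictly
-- (`exists_isQuasiBasis`), and `σ x = ∑ τ̂ (φ (v i * x * star (v i)))` is a lower semicontinuous
-- trace on `D` extending `τ̂ ∘ φ`. Its restriction to the corner `A ⊗ e₀₀` is densely defined,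
-- because a trace on a simple algebra that is finite at one nonzero positive element is densely
-- defined. Uniqueness therefore makes it a multiple of `τ` there, and a second quasi-basis, taken
-- inside `(a ⊗ e₀₀) D`, carries the proportionality to all of `D` (`exists_eq_mul_hat`). The
-- constant is not zero because `τ̂` is faithful.
--
-- The number `d_τ h` is the supremum of `τ̂` over the positive contractions of `her h`
-- (`hat_le_dim`, `dim_le_of_forall`), so it depends only on the hereditary subalgebra and its
-- trace, and `d_τ h₂ = c * d_τ h₁`. Hence `𝓕(A)` consists of the inverses of the scaling factors,
-- and it remains to see that these factors form a group.
--
-- The identity of a nonzero hereditary subalgebra of finite dimension gives `1`, and `φ⁻¹` gives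
-- inverses. For products the target of `φ` and the source of `ψ` need not agree. By simplicity
-- there is a nonzero `x = k y h` linking the two; the partial isometry in its polar decomposition,
-- approximated inside `D`, identifies nonzero hereditary subalgebras of each without changing the
-- trace (`exists_iso_of_ne_zero`). After restriction to these, `φ` and `ψ` can be composed and
-- their factors multiply.

universe u v w

namespace FundGroup

/-! ### Lower semicontinuous traces on C⋆-algebras -/

section GenericTraces

/-- Polarization. -/
lemma star_mul_eq_polarization {D : Type u} [NonUnitalCStarAlgebra D] (x y : D) :
    star y * x = (1 / 4 : ℂ) • (star (x + y) * (x + y) - star (x - y) * (x - y)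
      + Complex.I • (star (x + Complex.I • y) * (x + Complex.I • y))
      - Complex.I • (star (x - Complex.I • y) * (x - Complex.I • y))) := by
  simp only [star_add, star_sub, star_smul, mul_add, add_mul, sub_mul, mul_sub, smul_mul_assoc,
    mul_smul_comm, smul_add, smul_sub, smul_smul, Complex.star_def, Complex.conj_I]
  match_scalars <;> ring_nf <;> simp <;> ring_nf

/-- Left multiplications by the `q n` are uniformly bounded, so the set of points at which they
converge to the identity is closed. -/
lemma tendsto_mul_of_mem_closure {D : Type u} [NonUnitalCStarAlgebra D] {q : ℕ → D} {C : ℝ}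
    (hq : ∀ n, ‖q n‖ ≤ C) {s : Set D} (hs : ∀ x ∈ s, Tendsto (fun n => q n * x) atTop (𝓝 x))
    {x : D} (hx : x ∈ closure s) : Tendsto (fun n => q n * x) atTop (𝓝 x) := by
  have hC : 0 ≤ C := (norm_nonneg _).trans (hq 0)
  refine Metric.tendsto_atTop.2 fun ε hε => ?_
  obtain ⟨y, hy, hxy⟩ := Metric.mem_closure_iff.1 hx (ε / (2 * (C + 1))) (by positivity)
  obtain ⟨N, hN⟩ := Metric.tendsto_atTop.1 (hs y hy) (ε / 2) (by positivity)
  refine ⟨N, fun n hn => ?_⟩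
  have h1 := hN n hn
  rw [dist_eq_norm] at hxy h1 ⊢
  have h2 : q n * x - x = q n * (x - y) + (q n * y - y) + -(x - y) := by rw [mul_sub]; abel
  have h3 : ‖q n * (x - y)‖ ≤ C * ‖x - y‖ :=
    (norm_mul_le _ _).trans (mul_le_mul_of_nonneg_right (hq n) (norm_nonneg _))
  have h4 : (C + 1) * ‖x - y‖ < ε / 2 := by
    rw [lt_div_iff₀ (by positivity)] at hxy
    linarith
  rw [h2]
  refine norm_add₃_le.trans_lt ?_
  rw [norm_neg]
  linarith

variable {D : Type u} [NonUnitalCStarAlgebra D] [PartialOrder D] [StarOrderedRing D]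

/-- A family of nonnegative elements whose finite sums are bounded by `x` and approach `x`
along some sequence of finite sets is summable with sum `x`. -/
lemma hasSum_of_sum_le_of_tendsto {ι : Type*} {f : ι → D} {x : D} (hf : ∀ i, 0 ≤ f i)
    (hle : ∀ F : Finset ι, ∑ i ∈ F, f i ≤ x) (G : ℕ → Finset ι)
    (hG : Tendsto (fun n => ∑ i ∈ G n, f i) atTop (𝓝 x)) : HasSum f x := by
  classical
  rw [HasSum, SummationFilter.unconditional_filter]
  refine Metric.tendsto_atTop.2 ?_
  intro ε hε
  obtain ⟨n, hn⟩ := (Metric.tendsto_atTop.1 hG) ε hε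
  refine ⟨G n, fun F hF => ?_⟩
  have h := hn n le_rfl
  rw [dist_comm, dist_eq_norm] at h ⊢
  -- For `F ⊇ G n` one has `0 ≤ x - ∑ F ≤ x - ∑ G n`, and the norm is monotone on positive elements.
  refine lt_of_le_of_lt (CStarAlgebra.norm_le_norm_of_nonneg_of_le
    (sub_nonneg.2 (hle F)) ?_) h
  exact sub_le_sub_left (Finset.sum_le_sum_of_subset_of_nonneg hF fun i _ _ => hf i) _

lemma star_mul_conj_le (x y : D) :
    star (x * y) * (x * y) ≤ ‖x‖ ^ 2 • (star y * y) := by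
  have := CStarAlgebra.star_left_conjugate_le_norm_smul (a := y) (b := star x * x)
    (IsSelfAdjoint.star_mul_self x)
  rw [CStarRing.norm_star_mul_self, ← sq] at this
  simpa only [star_mul, mul_assoc] using this

lemma star_mul_add_le (x y : D) :
    star (x + y) * (x + y) ≤ (2 : ℝ) • (star x * x + star y * y) := by
  have h := star_mul_self_nonneg (x - y)
  rw [← sub_nonneg]
  convert h using 1
  rw [two_smul]
  simp only [star_add, star_sub, mul_add, add_mul, sub_mul, mul_sub]
  abel

namespace PosTrace

variable (τ : PosTrace D)

lemma map_smul_real {r : ℝ} (hr : 0 ≤ r) {a : D} (ha : 0 ≤ a) :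
    τ.toFun (r • a) = ENNReal.ofReal r * τ.toFun a := by
  have := τ.map_smul r.toNNReal a ha
  rwa [Complex.coe_smul, Real.coe_toNNReal r hr] at this

variable {τ}

lemma mono {a b : D} (ha : 0 ≤ a) (hab : a ≤ b) : τ.toFun a ≤ τ.toFun b := by
  have h := τ.map_add a (b - a) ha (sub_nonneg.2 hab)
  rw [add_sub_cancel] at h
  rw [h]
  exact le_self_add

lemma map_sum {ι : Type*} {f : ι → D} (hf : ∀ i, 0 ≤ f i) (F : Finset ι) :
    τ.toFun (∑ i ∈ F, f i) = ∑ i ∈ F, τ.toFun (f i) := by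
  classical
  induction F using Finset.induction_on with
  | empty => simp [τ.map_zero]
  | insert a s ha ih =>
    rw [Finset.sum_insert ha, Finset.sum_insert ha, ← ih]
    exact τ.map_add _ _ (hf a) (Finset.sum_nonneg fun i _ => hf i)

lemma IsLSC.le_of_tendsto (hτ : τ.IsLSC) {α : Type*} {l : Filter α} [l.NeBot] {f : α → D} {x : D}
    {c : ℝ≥0∞} (hx : Tendsto f l (𝓝 x)) (hf : ∀ i, 0 ≤ f i) (hc : ∀ᶠ i in l, τ.toFun (f i) ≤ c) :
    τ.toFun x ≤ c := by
  by_contra! hlt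
  have hx0 : 0 ≤ x := CStarAlgebra.isClosed_nonneg.mem_of_tendsto hx (Eventually.of_forall hf)
  have h1 := hτ x hx0 c hlt
  have h2 : Tendsto f l (𝓝[{a : D | 0 ≤ a}] x) :=
    tendsto_nhdsWithin_iff.2 ⟨hx, Eventually.of_forall hf⟩
  obtain ⟨i, hi, hi'⟩ := ((h2.eventually h1).and hc).exists
  exact absurd hi (not_lt.2 hi')

/-- Lower semicontinuity along the net of finite partial sums gives `≤`; monotonicity and finite
additivity give `≥`. -/
lemma IsLSC.hasSum (hτ : τ.IsLSC) {ι : Type*} {f : ι → D} {x : D} (hf : ∀ i, 0 ≤ f i)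
    (hx : HasSum f x) : τ.toFun x = ∑' i, τ.toFun (f i) := by
  apply le_antisymm
  · refine hτ.le_of_tendsto (l := atTop) hx (fun F => Finset.sum_nonneg fun i _ => hf i) ?_
    refine Eventually.of_forall fun F => ?_
    rw [map_sum hf]
    exact ENNReal.sum_le_tsum F
  · rw [ENNReal.tsum_eq_iSup_sum]
    refine iSup_le fun F => ?_
    rw [← map_sum hf]
    exact mono (Finset.sum_nonneg fun i _ => hf i) (sum_le_hasSum F (fun i _ => hf i) hx)

lemma apply_star_mul_left_le (x y : D) :
    τ.toFun (star (x * y) * (x * y)) ≤ ENNReal.ofReal (‖x‖ ^ 2) * τ.toFun (star y * y) := by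
  rw [← τ.map_smul_real (by positivity) (star_mul_self_nonneg y)]
  exact mono (star_mul_self_nonneg _) (star_mul_conj_le x y)

lemma apply_star_mul_right_le (x y : D) :
    τ.toFun (star (x * y) * (x * y)) ≤ ENNReal.ofReal (‖y‖ ^ 2) * τ.toFun (star x * x) := by
  have h := apply_star_mul_left_le (τ := τ) (star y) (star x)
  rw [star_star, norm_star, ← τ.map_star_mul_self x] at h
  rw [τ.map_star_mul_self]
  simpa only [star_mul, star_star] using h

lemma apply_star_add_le (x y : D) :
    τ.toFun (star (x + y) * (x + y)) ≤
      2 * (τ.toFun (star x * x) + τ.toFun (star y * y)) := by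
  rw [← τ.map_add _ _ (star_mul_self_nonneg x) (star_mul_self_nonneg y)]
  have h := τ.map_smul_real (r := 2) (by norm_num)
    (add_nonneg (star_mul_self_nonneg x) (star_mul_self_nonneg y))
  rw [show ENNReal.ofReal 2 = 2 by simp] at h
  rw [← h]
  exact mono (star_mul_self_nonneg _) (star_mul_add_le x y)

lemma apply_star_smul (c : ℂ) (x : D) :
    τ.toFun (star (c • x) * (c • x)) = ENNReal.ofReal (‖c‖ ^ 2) * τ.toFun (star x * x) := by
  rw [← τ.map_smul_real (by positivity) (star_mul_self_nonneg x)]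
  congr 1
  rw [star_smul, smul_mul_smul_comm, ← Complex.coe_smul]
  congr 1
  simp [← Complex.normSq_eq_conj_mul_self, Complex.normSq_eq_norm_sq]

/-- A nonzero lower semicontinuous trace on a simple C⋆-algebra is faithful. -/
lemma IsLSC.faithful (hτ : τ.IsLSC) (hD : IsSimple D) {a : D} (ha : 0 ≤ a) (ha' : τ.toFun a ≠ 0)
    {x : D} (hx : τ.toFun (star x * x) = 0) : x = 0 := by
  -- The set of `y` with `τ (y⋆ y) = 0` is a two-sided ideal by the two estimates for `τ ((xy)⋆
  -- (xy))`, closed by lower semicontinuity, and proper because it misses `√a`.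
  let I : Submodule ℂ D :=
    { carrier := {y | τ.toFun (star y * y) = 0}
      add_mem' := fun {y z} hy hz => by
        have h := apply_star_add_le (τ := τ) y z
        rw [Set.mem_ofPred_eq] at hy hz
        rw [hy, hz] at h
        simpa using h
      zero_mem' := by simp [τ.map_zero]
      smul_mem' := fun c y hy => by
        rw [Set.mem_ofPred_eq] at hy ⊢
        rw [apply_star_smul, hy, mul_zero] }
  have hI : IsClosed (I : Set D) := by
    refine isClosed_of_closure_subset fun y hy => ?_
    obtain ⟨s, hs, hsy⟩ := mem_closure_iff_seq_limit.1 hy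
    have h1 : Tendsto (fun n => star (s n) * s n) atTop (𝓝 (star y * y)) := hsy.star.mul hsy
    exact le_antisymm (hτ.le_of_tendsto h1 (fun n => star_mul_self_nonneg _)
      (Eventually.of_forall fun n => (hs n).le)) zero_le
  rcases hD.2 I hI (fun b y hy => by
    have hy' : τ.toFun (star y * y) = 0 := hy
    refine ⟨?_, ?_⟩
    · have h := apply_star_mul_left_le (τ := τ) b y
      rw [hy', mul_zero] at h
      exact le_antisymm h zero_le
    · have h := apply_star_mul_right_le (τ := τ) y b
      rw [hy', mul_zero] at h
      exact le_antisymm h zero_le) with h | h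
  · have : x ∈ I := hx
    rwa [h, Submodule.mem_bot] at this
  · have : CFC.sqrt a ∈ I := by rw [h]; trivial
    have h2 : τ.toFun (star (CFC.sqrt a) * CFC.sqrt a) = 0 := this
    rw [(IsSelfAdjoint.of_nonneg (CFC.sqrt_nonneg a)).star_eq, CFC.sqrt_mul_sqrt_self a ha] at h2
    exact absurd h2 ha'

end PosTrace

namespace PosTrace

variable {τ : PosTrace D}

/-- By polarization `y⋆ x` is a combination of the four squares of `x + iᵏ y`, each of finite trace.
-/
lemma star_mul_mem_span {x y : D} (hx : τ.toFun (star x * x) < ∞) (hy : τ.toFun (star y * y) < ∞) :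
    star y * x ∈ Submodule.span ℂ {a : D | 0 ≤ a ∧ τ.toFun a < ∞} := by
  have key : ∀ c : ℂ, star (x + c • y) * (x + c • y) ∈
      Submodule.span ℂ {a : D | 0 ≤ a ∧ τ.toFun a < ∞} := fun c => by
    refine Submodule.subset_span ⟨star_mul_self_nonneg _, (apply_star_add_le _ _).trans_lt ?_⟩
    rw [apply_star_smul]
    refine ENNReal.mul_lt_top (by simp) (ENNReal.add_lt_top.2 ⟨hx, ENNReal.mul_lt_top (by simp) hy⟩)
  rw [star_mul_eq_polarization]
  have h1 := key 1
  have h2 := key (-1)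
  have h3 := key Complex.I
  have h4 := key (-Complex.I)
  rw [one_smul] at h1
  rw [neg_smul, one_smul, ← sub_eq_add_neg] at h2
  rw [neg_smul, ← sub_eq_add_neg] at h4
  exact Submodule.smul_mem _ _ (Submodule.sub_mem _ (Submodule.add_mem _ (Submodule.sub_mem _ h1 h2)
    (Submodule.smul_mem _ _ h3)) (Submodule.smul_mem _ _ h4))

/-- On a simple C⋆-algebra, a trace which is finite on some nonzero positive element is densely
defined. -/
lemma isDenselyDefined_of_simple (hD : IsSimple D) {x : D} (hx : x ≠ 0)
    (hfin : τ.toFun (star x * x) < ∞) : τ.IsDenselyDefined := by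
  set N := Submodule.span ℂ {a : D | 0 ≤ a ∧ τ.toFun a < ∞} with hN
  have sqrt_spec : ∀ a : D, 0 ≤ a → star (CFC.sqrt a) * CFC.sqrt a = a := fun a ha => by
    rw [(IsSelfAdjoint.of_nonneg (CFC.sqrt_nonneg a)).star_eq, CFC.sqrt_mul_sqrt_self a ha]
  -- Splitting `a = √a √a` writes `a b` and `b a` as products of two elements with squares of finite
  -- trace, to which polarization applies.
  have hl : ∀ b : D, ∀ y ∈ N, b * y ∈ N ∧ y * b ∈ N := by
    intro b y hy
    induction hy using Submodule.span_induction with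
    | mem a ha =>
      obtain ⟨ha0, hat⟩ := ha
      have hs : τ.toFun (star (CFC.sqrt a) * CFC.sqrt a) < ∞ := by rwa [sqrt_spec a ha0]
      have hsb : ∀ b, τ.toFun (star (CFC.sqrt a * b) * (CFC.sqrt a * b)) < ∞ := fun b =>
        (apply_star_mul_right_le _ _).trans_lt (ENNReal.mul_lt_top (by simp) hs)
      constructor
      · have := star_mul_mem_span hs (hsb (star b))
        rwa [star_mul, star_star, mul_assoc, sqrt_spec a ha0] at this
      · have := star_mul_mem_span (hsb b) hs
        rwa [← mul_assoc, sqrt_spec a ha0] at this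
    | zero => simp
    | add y z _ _ hy hz =>
      rw [mul_add, add_mul]
      exact ⟨N.add_mem hy.1 hz.1, N.add_mem hy.2 hz.2⟩
    | smul c y _ hy =>
      rw [mul_smul_comm, smul_mul_assoc]
      exact ⟨N.smul_mem _ hy.1, N.smul_mem _ hy.2⟩
  rcases hD.2 N.topologicalClosure N.isClosed_topologicalClosure (fun b y hy => by
    constructor
    · exact map_mem_closure (f := fun y => b * y) (by fun_prop) hy fun z hz => (hl b z hz).1
    · exact map_mem_closure (f := fun y => y * b) (by fun_prop) hy fun z hz => (hl b z hz).2)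
    with h | h
  · have h1 : star x * x ∈ N.topologicalClosure :=
      N.le_topologicalClosure (Submodule.subset_span ⟨star_mul_self_nonneg x, hfin⟩)
    rw [h, Submodule.mem_bot, CStarRing.star_mul_self_eq_zero_iff] at h1
    exact absurd h1 hx
  · exact Submodule.dense_iff_topologicalClosure_eq_top.2 h

end PosTrace

/-! ### The trace of an abstract infinite matrix -/

section MatrixTrace

variable {C : Type v} [NonUnitalCStarAlgebra C] [PartialOrder C] [StarOrderedRing C]
  {ι : Type w} {F : ι → ι → D →L[ℂ] C}

/-- `F` behaves like the family of entry maps of an `ι × ι` matrix with entries in `C`. -/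
structure IsEntryFamily (F : ι → ι → D →L[ℂ] C) : Prop where
  map_star : ∀ i j x, F i j (star x) = star (F j i x)
  hasSum : ∀ i x, HasSum (fun j => star (F j i x) * F j i x) (F i i (star x * x))

lemma IsEntryFamily.nonneg (hF : IsEntryFamily F) (i : ι) {x : D} (hx : 0 ≤ x) :
    0 ≤ F i i x := by
  obtain ⟨y, rfl⟩ := CStarAlgebra.nonneg_iff_eq_star_mul_self.1 hx
  exact (hF.hasSum i y).nonneg fun j => star_mul_self_nonneg _

/-- The trace `x ↦ ∑ τ (F i i x)`. -/
noncomputable def matTrace (τ : PosTrace C) (hτ : τ.IsLSC) (hF : IsEntryFamily F) :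
    PosTrace D where
  toFun x := ∑' i, τ.toFun (F i i x)
  map_zero := by simp [τ.map_zero]
  map_add a b ha hb := by
    rw [← ENNReal.tsum_add]
    refine tsum_congr fun i => ?_
    rw [map_add, τ.map_add _ _ (hF.nonneg i ha) (hF.nonneg i hb)]
  map_smul c a ha := by
    rw [← ENNReal.tsum_mul_left]
    refine tsum_congr fun i => ?_
    rw [_root_.map_smul, τ.map_smul _ _ (hF.nonneg i ha)]
  map_star_mul_self a := by
    -- Both sides become double sums of `τ` over squares of entries; they agree after exchanging the
    -- sums and applying the trace property entrywise.
    have h : ∀ x i, τ.toFun (F i i (star x * x)) = ∑' j, τ.toFun (star (F j i x) * F j i x) :=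
      fun x i => hτ.hasSum (fun j => star_mul_self_nonneg _) (hF.hasSum i x)
    have h2 := h (star a)
    simp only [star_star] at h2
    simp only [h a, h2]
    rw [ENNReal.tsum_comm]
    refine tsum_congr fun i => tsum_congr fun j => ?_
    rw [hF.map_star, star_star, τ.map_star_mul_self]

lemma matTrace_apply (τ : PosTrace C) (hτ : τ.IsLSC) (hF : IsEntryFamily F) (x : D) :
    (matTrace τ hτ hF).toFun x = ∑' i, τ.toFun (F i i x) := rfl

lemma matTrace_isLSC (τ : PosTrace C) (hτ : τ.IsLSC) (hF : IsEntryFamily F) :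
    (matTrace τ hτ hF).IsLSC := by
  refine lowerSemicontinuousOn_tsum fun i => ?_
  exact LowerSemicontinuousOn.comp hτ (F i i).continuous.continuousOn fun x hx => hF.nonneg i hx

end MatrixTrace

end GenericTraces

/-! ### Strict decompositions of the unit inside a right ideal `bD` -/

section QuasiBasis

variable {D : Type u} [NonUnitalCStarAlgebra D]

lemma mul_star_mul_self_ne_zero {x : D} (hx : x ≠ 0) : x * star x * x ≠ 0 := fun h => by
  have h1 : star (star x * x) * (star x * x) = 0 := by
    rw [star_mul, star_star]
    calc star x * x * (star x * x) = star x * (x * star x * x) := by simp only [mul_assoc]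
      _ = 0 := by rw [h, mul_zero]
  rw [CStarRing.star_mul_self_eq_zero_iff, CStarRing.star_mul_self_eq_zero_iff] at h1
  exact hx h1

/-- The closed span is an ideal. Without a unit it is not obvious that it is nonzero; it contains `b
b⋆ b b⋆ b`, which does not vanish. -/
lemma dense_span_mul_mul (hD : IsSimple D) {b : D} (hb : b ≠ 0) :
    Dense (Submodule.span ℂ {a : D | ∃ y x, a = y * b * x} : Set D) := by
  set N := Submodule.span ℂ {a : D | ∃ y x, a = y * b * x}
  have hl : ∀ c : D, ∀ y ∈ N, c * y ∈ N ∧ y * c ∈ N := by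
    intro c y hy
    induction hy using Submodule.span_induction with
    | mem a ha =>
      obtain ⟨y, x, rfl⟩ := ha
      exact ⟨Submodule.subset_span ⟨c * y, x, by simp only [mul_assoc]⟩,
        Submodule.subset_span ⟨y, x * c, by simp only [mul_assoc]⟩⟩
    | zero => simp
    | add y z _ _ hy hz =>
      rw [mul_add, add_mul]
      exact ⟨N.add_mem hy.1 hz.1, N.add_mem hy.2 hz.2⟩
    | smul r y _ hy =>
      rw [mul_smul_comm, smul_mul_assoc]
      exact ⟨N.smul_mem _ hy.1, N.smul_mem _ hy.2⟩
  rcases hD.2 N.topologicalClosure N.isClosed_topologicalClosure (fun b y hy => by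
    constructor
    · exact map_mem_closure (f := fun y => b * y) (by fun_prop) hy fun z hz => (hl b z hz).1
    · exact map_mem_closure (f := fun y => y * b) (by fun_prop) hy fun z hz => (hl b z hz).2)
    with h | h
  · have h0 : (b * star b) * b * (star b * b) ∈ N.topologicalClosure :=
      N.le_topologicalClosure (Submodule.subset_span ⟨b * star b, star b * b, rfl⟩)
    rw [h, Submodule.mem_bot] at h0
    have h1 := mul_star_mul_self_ne_zero hb
    have h2 : star (b * star b * b) * (b * star b * b) = 0 := by
      calc star (b * star b * b) * (b * star b * b)
          = star b * (b * star b * b * (star b * b)) := by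
            simp only [star_mul, star_star, mul_assoc]
        _ = 0 := by rw [h0, mul_zero]
    exact absurd ((CStarRing.star_mul_self_eq_zero_iff _).1 h2) h1
  · exact Submodule.dense_iff_topologicalClosure_eq_top.2 h

variable [PartialOrder D] [StarOrderedRing D]

lemma star_mul_mul_le_of_norm_le_one {s : D} (hs : 0 ≤ s) (hs1 : ‖s‖ ≤ 1) (x : D) :
    star x * s * x ≤ star x * x := by
  refine (CStarAlgebra.star_left_conjugate_le_norm_smul (IsSelfAdjoint.of_nonneg hs)).trans ?_
  have := smul_le_smul_of_nonneg_right hs1 (star_mul_self_nonneg x)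
  rwa [one_smul] at this

/-- There is no `1` in `D` to compare with. Testing at `x = √s` gives `s² ≤ s`, hence `‖s‖² ≤ ‖s‖`.
-/
lemma norm_le_one_of_star_mul_mul_le {s : D} (hs : 0 ≤ s)
    (h : ∀ x, star x * s * x ≤ star x * x) : ‖s‖ ≤ 1 := by
  have hsq := CFC.sqrt_nonneg s
  have h1 := h (CFC.sqrt s)
  have h2 : CFC.sqrt s * s * CFC.sqrt s = star s * s := by
    rw [(IsSelfAdjoint.of_nonneg hs).star_eq]
    nth_rw 2 [← CFC.sqrt_mul_sqrt_self s hs]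
    rw [mul_assoc, mul_assoc, ← mul_assoc (CFC.sqrt s), CFC.sqrt_mul_sqrt_self s hs]
  rw [(IsSelfAdjoint.of_nonneg hsq).star_eq, CFC.sqrt_mul_sqrt_self s hs, h2] at h1
  have h3 := CStarAlgebra.norm_le_norm_of_nonneg_of_le (star_mul_self_nonneg s) h1
  rw [CStarRing.norm_star_mul_self] at h3
  by_contra! hlt
  nlinarith

/-- For `k ≥ 0` and small `δ`, the element `v = k² (k + δ)⁻²` acts almost as a unit on `k`. -/
lemma exists_approx_unit_of_nonneg {k : D} (hk : 0 ≤ k) {δ : ℝ} (hδ : 0 < δ) :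
    ∃ g : D, IsSelfAdjoint g ∧ ‖g * k * g‖ ≤ 1 ∧
      ‖k - g * k * g * k - k * (g * k * g) + g * k * g * k * (g * k * g)‖ ≤ 4 * δ := by
  -- With `g = f(k)`, `g k g` is `k² (k + δ)⁻²`. The absolute value only serves to make `f`
  -- continuous on all of `ℝ`.
  set f : ℝ → ℝ := fun t => √t / (|t| + δ) with hf
  have hpos : ∀ t : ℝ, |t| + δ ≠ 0 := fun t => by positivity
  have hfc : Continuous f := by
    rw [hf]; exact Real.continuous_sqrt.div (by fun_prop) hpos
  have hf0 : f 0 = 0 := by simp [hf]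
  have hid : cfcₙ (fun t : ℝ => t) k = k := cfcₙ_id' ℝ k
  have hv : cfcₙ f k * k * cfcₙ f k = cfcₙ (fun t : ℝ => f t * t * f t) k := by
    nth_rw 2 [← hid]
    rw [← cfcₙ_mul f (fun t => t) k, ← cfcₙ_mul (fun t => f t * t) f k]
  set G : ℝ → ℝ := fun t => f t * t * f t with hG
  have hGc : Continuous G := by rw [hG]; fun_prop
  have hG0 : G 0 = 0 := by simp [hG]
  have hGt : ∀ t : ℝ, 0 ≤ t → G t = t ^ 2 / (t + δ) ^ 2 := fun t ht => by
    simp only [hG, hf, abs_of_nonneg ht]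
    rw [div_mul_eq_mul_div, div_mul_div_comm, mul_right_comm, Real.mul_self_sqrt ht]
    ring
  refine ⟨cfcₙ f k, cfcₙ_predicate f k, ?_, ?_⟩
  · rw [hv]
    refine norm_cfcₙ_le fun t ht => ?_
    have ht0 := quasispectrum_nonneg_of_nonneg k hk t ht
    rw [hGt t ht0, Real.norm_of_nonneg (by positivity), div_le_one (by positivity)]
    gcongr; linarith
  · rw [hv]
    have h : k - cfcₙ G k * k - k * cfcₙ G k + cfcₙ G k * k * cfcₙ G k =
        cfcₙ (fun t : ℝ => t - G t * t - t * G t + G t * t * G t) k := by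
      rw [cfcₙ_add (fun t : ℝ => t - G t * t - t * G t) (fun t => G t * t * G t) k,
        cfcₙ_sub (fun t : ℝ => t - G t * t) (fun t => t * G t) k,
        cfcₙ_sub (fun t : ℝ => t) (fun t => G t * t) k, cfcₙ_mul G (fun t => t) k,
        cfcₙ_mul (fun t => t) G k, cfcₙ_mul (fun t => G t * t) G k, cfcₙ_mul G (fun t => t) k, hid]
    rw [h]
    refine norm_cfcₙ_le fun t ht => ?_
    have ht0 := quasispectrum_nonneg_of_nonneg k hk t ht
    have h1 : t - G t * t - t * G t + G t * t * G t = t * (1 - G t) ^ 2 := by ring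
    have h2 : 1 - G t = (2 * t * δ + δ ^ 2) / (t + δ) ^ 2 := by
      rw [hGt t ht0]; field_simp; ring
    have h3 : 0 ≤ 1 - G t := by rw [h2]; positivity
    have h4 : 1 - G t ≤ 1 := by rw [hGt t ht0]; simp; positivity
    -- Here `t (1 - G t) = t δ (2t + δ) / (t + δ)²`; the second factor `1 - G t ≤ 1` does not
    -- increase the bound.
    have h5 : t * (1 - G t) ≤ 2 * δ := by
      rw [h2, mul_div_assoc', div_le_iff₀ (by positivity)]
      nlinarith [mul_nonneg ht0 hδ.le, mul_nonneg (mul_nonneg ht0 hδ.le) hδ.le,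
        pow_pos hδ 3]
    rw [h1, Real.norm_of_nonneg (by positivity)]
    nlinarith [mul_nonneg ht0 h3]

/-- In a simple C⋆-algebra, a sum of elements `star w * w` with `w ∈ bD` can be taken to act almost
as a unit on a given element. -/
lemma exists_sum_star_mul_approx_unit (hD : IsSimple D) {b : D} (hb : b ≠ 0)
    (a : D) {ε : ℝ} (hε : 0 < ε) :
    ∃ (K : ℕ) (w : Fin K → D), (∀ j, ∃ z, w j = b * z) ∧ ‖∑ j, star (w j) * w j‖ ≤ 1 ∧
      ‖star a * a - star a * (∑ j, star (w j) * w j) * a‖ ≤ ε := by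
  have hb' : star b ≠ 0 := star_ne_zero.2 hb
  -- Replacing `a` by a nearby `a₀` costs `η` twice and the defect of `v` on `a₀` costs `η` once;
  -- the outer factor `star a` costs `‖a‖`.
  set η : ℝ := ε / (3 * (‖a‖ + 1)) with hη
  have hη0 : 0 < η := by positivity
  obtain ⟨a₀, ha₀, haa⟩ := Metric.dense_iff.1 (dense_span_mul_mul hD hb') a η hη0
  rw [Metric.mem_ball, dist_eq_norm] at ha₀
  obtain ⟨K, c, y, hy⟩ := (Submodule.mem_span_set' (R := ℂ)).1 haa
  choose p x hpx using fun j => (y j).2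
  set q : Fin K → D := fun j => b * star (p j) with hq
  have ha₀q : a₀ = ∑ j, star (q j) * (c j • x j) := by
    rw [← hy]
    refine Finset.sum_congr rfl fun j _ => ?_
    simp only [hpx j, hq, star_mul, star_star, mul_smul_comm]
  set k := ∑ j, star (q j) * q j with hk
  set M : ℝ := ∑ j, ‖c j • x j‖
  have hM : 0 ≤ M := Finset.sum_nonneg fun j _ => norm_nonneg _
  -- If every `‖q j - q j * v‖` is at most `r`, the defect on `a₀` is at most `r M ≤ η`. The choice
  -- `δ = r² / 4` turns the bound `4δ` into `r²`, and taking square roots gives `r`.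
  set r : ℝ := η / (M + 1) with hr
  have hr0 : 0 < r := by positivity
  obtain ⟨g, hg, hg1, hgk⟩ := exists_approx_unit_of_nonneg
    (k := k) (Finset.sum_nonneg fun j _ => star_mul_self_nonneg _) (δ := r ^ 2 / 4) (by positivity)
  have hv : ∑ j, star (q j * g) * (q j * g) = g * k * g := by
    rw [hk, Finset.mul_sum, Finset.sum_mul]
    exact Finset.sum_congr rfl fun j _ => by simp only [star_mul, hg.star_eq, mul_assoc]
  have hvs : star (g * k * g) = g * k * g := by
    rw [← hv, star_sum]
    exact Finset.sum_congr rfl fun j _ => by simp only [star_mul, star_star, mul_assoc]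
  set v := g * k * g
  have hqv : ∀ j, ‖star (q j) - v * star (q j)‖ ≤ r := fun j => by
    -- The squares sum to `(1 - v) k (1 - v)`, which has norm at most `r²` and dominates each of
    -- them.
    have h1 : ∑ j, star (q j - q j * v) * (q j - q j * v) = k - v * k - k * v + v * k * v := by
      rw [hk, Finset.mul_sum, Finset.sum_mul, Finset.sum_mul, ← Finset.sum_sub_distrib,
        ← Finset.sum_sub_distrib, ← Finset.sum_add_distrib]
      refine Finset.sum_congr rfl fun j _ => ?_
      simp only [star_sub, star_mul, hvs, mul_sub, sub_mul, mul_assoc]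
      abel
    have h2 : star (q j - q j * v) * (q j - q j * v) ≤ k - v * k - k * v + v * k * v := by
      rw [← h1]
      exact Finset.single_le_sum (f := fun j => star (q j - q j * v) * (q j - q j * v))
        (fun j _ => star_mul_self_nonneg _) (Finset.mem_univ j)
    have h3 := CStarAlgebra.norm_le_norm_of_nonneg_of_le (star_mul_self_nonneg _) h2
    rw [CStarRing.norm_star_mul_self] at h3
    have h4 : star (q j) - v * star (q j) = star (q j - q j * v) := by
      rw [star_sub, star_mul (q j), hvs]
    rw [h4, norm_star]
    have h5 : k - v * k - k * v + v * k * v =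
        k - g * k * g * k - k * (g * k * g) + g * k * g * k * (g * k * g) := rfl
    rw [← h5] at hgk
    nlinarith [norm_nonneg (q j - q j * v)]
  have hav : ‖a₀ - v * a₀‖ ≤ η := by
    have h1 : a₀ - v * a₀ = ∑ j, (star (q j) - v * star (q j)) * (c j • x j) := by
      rw [ha₀q, Finset.mul_sum, ← Finset.sum_sub_distrib]
      exact Finset.sum_congr rfl fun j _ => by rw [sub_mul, mul_assoc v]
    rw [h1]
    calc _ ≤ ∑ j, r * ‖c j • x j‖ := (norm_sum_le _ _).trans (Finset.sum_le_sum fun j _ =>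
          (norm_mul_le _ _).trans (mul_le_mul_of_nonneg_right (hqv j) (norm_nonneg _)))
      _ = r * M := by rw [Finset.mul_sum]
      _ ≤ r * (M + 1) := by gcongr; linarith
      _ = η := by rw [hr]; field_simp
  have hav' : ‖a - v * a‖ ≤ 3 * η := by
    have h1 : a - v * a = -(a₀ - a) + (a₀ - v * a₀) + v * (a₀ - a) := by rw [mul_sub]; abel
    have h2 : ‖v * (a₀ - a)‖ ≤ 1 * ‖a₀ - a‖ :=
      (norm_mul_le _ _).trans (mul_le_mul_of_nonneg_right hg1 (norm_nonneg _))
    rw [h1]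
    refine (norm_add₃_le).trans ?_
    rw [norm_neg]
    linarith
  refine ⟨K, fun j => q j * g, fun j => ⟨star (p j) * g, by simp only [hq, mul_assoc]⟩, ?_, ?_⟩
  · rwa [hv]
  · rw [hv, mul_assoc, ← mul_sub]
    calc _ ≤ ‖a‖ * (3 * η) := (norm_mul_le _ _).trans (by rw [norm_star]; gcongr)
      _ ≤ (‖a‖ + 1) * (3 * η) := by gcongr; linarith
      _ = ε := by rw [hη]; field_simp

/-- The element `t = 1 - √(1 - s)`. -/
lemma exists_two_smul_sub_mul_self {s : D} (hs : 0 ≤ s) (hs1 : ‖s‖ ≤ 1) :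
    ∃ t : D, IsSelfAdjoint t ∧ t + t - t * t = s := by
  set f : ℝ → ℝ := fun x => 1 - √(1 - x) with hf
  have hfc : Continuous f := by rw [hf]; fun_prop
  have hf0 : f 0 = 0 := by simp [hf]
  refine ⟨cfcₙ f s, cfcₙ_predicate f s, ?_⟩
  rw [← cfcₙ_mul f f s, ← cfcₙ_add f f s, ← cfcₙ_sub (fun x => f x + f x) (fun x => f x * f x) s]
  conv_rhs => rw [← cfcₙ_id' ℝ s]
  refine cfcₙ_congr fun x hx => ?_
  have h1 : ‖x‖ ≤ 1 := (NonUnitalIsometricContinuousFunctionalCalculus.norm_quasispectrum_le s hx).trans hs1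
  have h2 : √(1 - x) * √(1 - x) = 1 - x :=
    Real.mul_self_sqrt (by linarith [(abs_le.1 h1).2])
  simp only [hf]
  linear_combination -h2

/-- Write formally `1 - s = (1 - t)²`. If `v = ∑ w j⋆ w j` is almost a unit on `(1 - t) a`, adding
the squares of `w j (1 - t)` to `s` leaves the defect `(1 - t)(1 - v)(1 - t)`: it is positive, which
keeps the new sum a contraction, and it is small at `a`. -/
lemma exists_extend_partial_sum (hD : IsSimple D) {b : D} (hb : b ≠ 0)
    {s : D} (hs : 0 ≤ s) (hs1 : ‖s‖ ≤ 1) (a : D) {ε : ℝ} (hε : 0 < ε) :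
    ∃ (K : ℕ) (w : Fin K → D), (∀ j, ∃ z, w j = b * z) ∧ ‖s + ∑ j, star (w j) * w j‖ ≤ 1 ∧
      ‖star a * a - star a * (s + ∑ j, star (w j) * w j) * a‖ ≤ ε := by
  obtain ⟨t, ht, rfl⟩ := exists_two_smul_sub_mul_self hs hs1
  obtain ⟨K, w, hw, hv, hva⟩ := exists_sum_star_mul_approx_unit hD hb (a - t * a) hε
  set v := ∑ j, star (w j) * w j with hvdef
  have hv0 : 0 ≤ v := Finset.sum_nonneg fun j _ => star_mul_self_nonneg _
  have hsum : ∑ j, star (w j - w j * t) * (w j - w j * t) = v - t * v - v * t + t * v * t := by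
    rw [hvdef, Finset.mul_sum, Finset.sum_mul, Finset.sum_mul, ← Finset.sum_sub_distrib,
      ← Finset.sum_sub_distrib, ← Finset.sum_add_distrib]
    refine Finset.sum_congr rfl fun j _ => ?_
    simp only [star_sub, star_mul, ht.star_eq, mul_sub, sub_mul, mul_assoc]
    abel
  -- The identity for the defect, placed between `star x` and `x` because `D` has no unit.
  have key : ∀ x, star x * x - star x * (t + t - t * t + (v - t * v - v * t + t * v * t)) * x =
      star (x - t * x) * (x - t * x) - star (x - t * x) * v * (x - t * x) := fun x => by
    simp only [star_sub, star_mul, ht.star_eq, mul_sub, sub_mul, mul_assoc, mul_add, add_mul]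
    abel
  refine ⟨K, fun j => w j - w j * t, fun j => ?_, ?_, ?_⟩
  · obtain ⟨z, hz⟩ := hw j
    exact ⟨z - z * t, by simp only [hz, mul_sub, mul_assoc]⟩
  · refine norm_le_one_of_star_mul_mul_le
      (add_nonneg hs (Finset.sum_nonneg fun j _ => star_mul_self_nonneg _)) fun x => ?_
    rw [hsum, ← sub_nonneg, key]
    exact sub_nonneg.2 (star_mul_mul_le_of_norm_le_one hv0 hv _)
  · rw [hsum, key]
    exact hva

/-- `∑ star (u i) * u i = 1` strictly. -/
def IsQuasiBasis {ι : Type*} (u : ι → D) : Prop :=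
  ∀ x : D, HasSum (fun i => star (u i * x) * (u i * x)) (star x * x)

/-- Greedy construction along the countable approximate unit: stage `n` adds finitely many squares
so that the partial sum, still a contraction, has defect at most `1 / (n + 1)` on `e n`.
Contractivity of the partial sums then transfers convergence from `e n * x` to `x`. -/
theorem exists_isQuasiBasis (hD : IsSimple D) (hσ : IsSigmaUnital D) {b : D} (hb : b ≠ 0) :
    ∃ (K : ℕ → ℕ) (u : (Σ n, Fin (K n)) → D), (∀ i, ∃ z, u i = b * z) ∧ IsQuasiBasis u := by
  obtain ⟨e, he, hlim⟩ := hσ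
  let T := {s : D // 0 ≤ s ∧ ‖s‖ ≤ 1}
  have step : ∀ (n : ℕ) (s : T), ∃ (K : ℕ) (w : Fin K → D), (∀ j, ∃ z, w j = b * z) ∧
      ‖(s : D) + ∑ j, star (w j) * w j‖ ≤ 1 ∧
      ‖star (e n) * e n - star (e n) * (s + ∑ j, star (w j) * w j) * e n‖ ≤ 1 / ((n : ℝ) + 1) :=
    fun n s => exists_extend_partial_sum hD hb s.2.1 s.2.2 (e n) (by positivity)
  choose K w hwb hw1 hwe using step
  let next : ℕ → T → T := fun n s => ⟨s + ∑ j, star (w n s j) * w n s j,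
    add_nonneg s.2.1 (Finset.sum_nonneg fun j _ => star_mul_self_nonneg _), hw1 n s⟩
  let S : ℕ → T := fun n => Nat.rec ⟨0, le_rfl, by simp⟩ next n
  let u : (Σ n, Fin (K n (S n))) → D := fun i => w i.1 (S i.1) i.2
  let G : ℕ → Finset (Σ n, Fin (K n (S n))) := fun n => (Finset.range n).sigma fun _ => Finset.univ
  have hG : ∀ n, ∑ i ∈ G n, star (u i) * u i = (S n).1 := by
    intro n
    induction n with
    | zero => rfl
    | succ n ih =>
      simp only [G, Finset.sum_sigma] at ih ⊢
      rw [Finset.sum_range_succ, ih]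
  refine ⟨fun n => K n (S n), u, fun i => hwb _ _ _, fun x => ?_⟩
  have hconj : ∀ F : Finset (Σ n, Fin (K n (S n))), ∑ i ∈ F, star (u i * x) * (u i * x) =
      star x * (∑ i ∈ F, star (u i) * u i) * x := fun F => by
    rw [Finset.mul_sum, Finset.sum_mul]
    exact Finset.sum_congr rfl fun i _ => by simp only [star_mul, mul_assoc]
  -- The shift by one: the partial sum adapted to `e n` is `S (n + 1)`.
  refine hasSum_of_sum_le_of_tendsto (fun i => star_mul_self_nonneg _) (fun F => ?_)
    (fun n => G (n + 1)) ?_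
  · obtain ⟨n, hn⟩ : ∃ n, F ⊆ G n := by
      refine ⟨F.sup (fun i => i.1 + 1), fun i hi => ?_⟩
      simp only [G, Finset.mem_sigma, Finset.mem_range, Finset.mem_univ, and_true]
      exact Nat.lt_of_succ_le (Finset.le_sup (f := fun i => i.1 + 1) hi)
    refine (Finset.sum_le_sum_of_subset_of_nonneg hn fun i _ _ => star_mul_self_nonneg _).trans ?_
    rw [hconj, hG]
    exact star_mul_mul_le_of_norm_le_one (S n).2.1 (S n).2.2 x
  · simp only [hconj, hG]
    have hstar : ∀ n, star (e n) = e n := fun n => (IsSelfAdjoint.of_nonneg (he n).1).star_eq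
    have hx := (hlim x).1
    have hd : Tendsto (fun n => e n * x - x) atTop (𝓝 0) := by simpa using hx.sub_const x
    -- the defect tends to zero along `e n * x`
    have h1 : Tendsto (fun n => star (e n * x) * (e n * x) -
        star (e n * x) * (S (n + 1) : D) * (e n * x)) atTop (𝓝 0) := by
      have hb : ∀ n, ‖star (e n * x) * (e n * x) - star (e n * x) * (S (n + 1) : D) * (e n * x)‖ ≤
          ‖x‖ * (1 / ((n : ℝ) + 1)) * ‖x‖ := fun n => by
        have : star (e n * x) * (e n * x) - star (e n * x) * (S (n + 1) : D) * (e n * x) =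
            star x * (star (e n) * e n - star (e n) * (S (n + 1) : D) * e n) * x := by
          simp only [star_mul, mul_sub, sub_mul, mul_assoc]
        rw [this]
        refine (norm_mul_le _ _).trans (mul_le_mul_of_nonneg_right ?_ (norm_nonneg _))
        refine (norm_mul_le _ _).trans ?_
        rw [norm_star]
        exact mul_le_mul_of_nonneg_left (hwe n (S n)) (norm_nonneg _)
      refine squeeze_zero_norm hb ?_
      simpa using (tendsto_one_div_add_atTop_nhds_zero_nat.const_mul ‖x‖).mul_const ‖x‖
    have h2 : Tendsto (fun n => star (e n * x) * (e n * x)) atTop (𝓝 (star x * x)) :=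
      hx.star.mul hx
    have h3 : Tendsto (fun n => star (e n * x) * (S (n + 1) : D) * (e n * x)) atTop
        (𝓝 (star x * x)) := by simpa using h2.sub h1
    -- As `‖S (n + 1)‖ ≤ 1`, replacing `e n * x` by `x` costs at most `2 ‖x‖ ‖e n * x - x‖`.
    have h4 : Tendsto (fun n => star (e n * x) * (S (n + 1) : D) * (e n * x) -
        star x * (S (n + 1) : D) * x) atTop (𝓝 0) := by
      have hb : ∀ n, ‖star (e n * x) * (S (n + 1) : D) * (e n * x) -
          star x * (S (n + 1) : D) * x‖ ≤ ‖e n * x - x‖ * (‖x‖ + ‖x‖) := fun n => by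
        have : star (e n * x) * (S (n + 1) : D) * (e n * x) - star x * (S (n + 1) : D) * x =
            star (e n * x - x) * (S (n + 1) : D) * (e n * x) +
              star x * (S (n + 1) : D) * (e n * x - x) := by
          simp only [star_sub, mul_sub, sub_mul]; abel
        rw [this]
        have hS := (S (n + 1)).2.2
        have hex : ‖e n * x‖ ≤ ‖x‖ := (norm_mul_le _ _).trans
          (mul_le_of_le_one_left (norm_nonneg _) (he n).2)
        have n1 : ‖star (e n * x - x) * (S (n + 1) : D) * (e n * x)‖ ≤ ‖e n * x - x‖ * 1 * ‖x‖ := by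
          refine (norm_mul_le _ _).trans (mul_le_mul ?_ hex (norm_nonneg _) (by positivity))
          refine (norm_mul_le _ _).trans ?_
          rw [norm_star]
          gcongr
        have n2 : ‖star x * (S (n + 1) : D) * (e n * x - x)‖ ≤ ‖x‖ * 1 * ‖e n * x - x‖ := by
          refine (norm_mul_le _ _).trans (mul_le_mul_of_nonneg_right ?_ (norm_nonneg _))
          refine (norm_mul_le _ _).trans ?_
          rw [norm_star]
          gcongr
        refine (norm_add_le _ _).trans ?_
        linarith
      refine squeeze_zero_norm hb ?_
      simpa using hd.norm.mul_const (‖x‖ + ‖x‖)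
    simpa using h3.sub h4

end QuasiBasis

/-! ### Matrix units, simplicity and traces of `A ⊗ 𝕂` -/

section MatrixUnits

variable {A : Type u} [NonUnitalCStarAlgebra A]

/-- The `n × n` matrix with `(i, j)`-entry `a` and zeros elsewhere. -/
def matSingle (n i j : ℕ) (a : A) : Mat A n :=
  CStarMatrix.ofMatrix fun p q => if (p : ℕ) = i ∧ (q : ℕ) = j then a else 0

lemma matSingle_apply (n i j : ℕ) (a : A) (p q : Fin n) :
    matSingle n i j a p q = if (p : ℕ) = i ∧ (q : ℕ) = j then a else 0 := rfl

lemma pad_matSingle {m n : ℕ} (h : m ≤ n) {i j : ℕ} (hi : i < m) (hj : j < m) (a : A) :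
    pad m n h (matSingle m i j a) = matSingle n i j a := by
  ext p q
  rw [pad_apply, matSingle_apply]
  by_cases hpq : (p : ℕ) = i ∧ (q : ℕ) = j
  · simp [hpq, hi, hj, matSingle_apply]
  · simp [hpq, matSingle_apply]

lemma matSingle_mul (n i : ℕ) (j : Fin n) (a : A) (M : Mat A n) (p q : Fin n) :
    (matSingle n i j a * M) p q = if (p : ℕ) = i then a * M j q else 0 := by
  rw [CStarMatrix.mul_apply, Finset.sum_eq_single j]
  · simp [matSingle_apply]
  · intro k _ hk
    simp [matSingle_apply, Fin.val_inj, hk]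
  · simp

lemma mul_matSingle (n : ℕ) (i : Fin n) (j : ℕ) (a : A) (M : Mat A n) (p q : Fin n) :
    (M * matSingle n i j a) p q = if (q : ℕ) = j then M p i * a else 0 := by
  rw [CStarMatrix.mul_apply, Finset.sum_eq_single i]
  · simp [matSingle_apply]
  · intro k _ hk
    simp [matSingle_apply, Fin.val_inj, hk]
  · simp

lemma sum_matSingle (n : ℕ) (M : Mat A n) : ∑ i, ∑ j, matSingle n (i : Fin n) (j : Fin n) (M i j) = M := by
  ext p q
  have h : ∀ (s : Finset (Fin n)) (f : Fin n → Mat A n), (∑ i ∈ s, f i) p q = ∑ i ∈ s, f i p q := by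
    intro s f
    classical
    induction s using Finset.induction_on with
    | empty => simp
    | insert a s ha ih => simp [Finset.sum_insert ha, ih]
  rw [h, Finset.sum_eq_single p, h, Finset.sum_eq_single q]
  · simp [matSingle_apply]
  · intro k _ hk
    simp [matSingle_apply, Fin.val_inj, Ne.symm hk]
  · simp
  · intro k _ hk
    rw [h]
    refine Finset.sum_eq_zero fun l _ => ?_
    simp [matSingle_apply, Fin.val_inj, Ne.symm hk]
  · simp

variable [PartialOrder A] [StarOrderedRing A]

/-- The element `a ⊗ e_{ij}` of `A ⊗ 𝕂`. -/
noncomputable def single (i j : ℕ) (a : A) : Stab A :=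
  Stab.coe (ofMat (max i j + 1) (matSingle (max i j + 1) i j a))

lemma single_eq {n i j : ℕ} (hi : i < n) (hj : j < n) (a : A) :
    single i j a = Stab.coe (ofMat n (matSingle n i j a)) := by
  rw [single, ← ofMat_pad (max i j + 1) n (by omega),
    pad_matSingle _ (by omega) (by omega)]

/-- Induction for closed properties of elements of `A ⊗ 𝕂`, with matrices of large size. -/
lemma Stab.ind_mat {p : Stab A → Prop} (k : ℕ) (hp : IsClosed {x | p x})
    (h : ∀ n, k ≤ n → ∀ M : Mat A n, p (Stab.coe (ofMat n M))) (x : Stab A) : p x := by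
  refine Stab.ind x hp fun y => ?_
  obtain ⟨n, M, rfl⟩ := MInf.exists₁ y
  rw [← ofMat_pad n (max n k) (le_max_left _ _)]
  exact h _ (le_max_right _ _) _

lemma entry_mat {n i j : ℕ} (hi : i < n) (hj : j < n) (M : Mat A n) :
    entry i j (Stab.coe (ofMat n M)) = M ⟨i, hi⟩ ⟨j, hj⟩ := by
  rw [entry_coe, entryLin_ofMat, dif_pos hi, dif_pos hj]

lemma Stab.coe_ofMat_mul (n : ℕ) (M N : Mat A n) :
    Stab.coe (ofMat n M) * Stab.coe (ofMat n N) = Stab.coe (ofMat n (M * N)) := by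
  rw [map_mul, Stab.coe_mul]

lemma Stab.star_coe_ofMat (n : ℕ) (M : Mat A n) :
    star (Stab.coe (ofMat n M)) = Stab.coe (ofMat n (star M)) := by
  rw [map_star, Stab.coe_star]

/-- The embedding `M_n(A) → A ⊗ 𝕂` as an additive map. -/
noncomputable def Stab.ofMatHom (n : ℕ) : Mat A n →+ Stab A where
  toFun M := Stab.coe (ofMat n M)
  map_zero' := by rw [map_zero, Stab.coe_zero]
  map_add' M N := by rw [map_add, Stab.coe_add]

lemma single_add (i j : ℕ) (a b : A) : single i j (a + b) = single i j a + single i j b := by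
  rw [single, single, single, ← Stab.coe_add, ← map_add]
  congr 2
  ext p q
  rw [CStarMatrix.add_apply]
  simp only [matSingle_apply]
  split_ifs <;> simp

lemma single_smul (i j : ℕ) (c : ℂ) (a : A) : single i j (c • a) = c • single i j a := by
  rw [single, single, ← Stab.coe_smul, ← _root_.map_smul]
  congr 2
  ext p q
  rw [CStarMatrix.smul_apply]
  simp only [matSingle_apply]
  split_ifs <;> simp

lemma single_zero (i j : ℕ) : single i j (0 : A) = 0 := by
  rw [← zero_smul ℂ (0 : A), single_smul, zero_smul]

lemma star_single (i j : ℕ) (a : A) : star (single i j a) = single j i (star a) := by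
  have hi : i < i + j + 1 := by omega
  have hj : j < i + j + 1 := by omega
  rw [single_eq hi hj, single_eq hj hi, Stab.star_coe_ofMat]
  congr 2
  ext p q
  rw [CStarMatrix.star_apply, matSingle_apply, matSingle_apply]
  simp only [and_comm]
  split_ifs <;> simp

lemma single_mul_single (i j k l : ℕ) (a b : A) :
    single i j a * single k l b = if j = k then single i l (a * b) else 0 := by
  have hi : i < i + j + k + l + 1 := by omega
  have hj : j < i + j + k + l + 1 := by omega
  have hk : k < i + j + k + l + 1 := by omega
  have hl : l < i + j + k + l + 1 := by omega
  rw [single_eq hi hj, single_eq hk hl, single_eq hi hl, Stab.coe_ofMat_mul]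
  split_ifs with h
  · congr 2
    ext p q
    rw [matSingle_mul _ _ ⟨j, hj⟩, matSingle_apply, matSingle_apply]
    simp only [h, true_and]
    split_ifs <;> simp_all
  · rw [← Stab.coe_zero, ← map_zero (ofMat (A := A) (i + j + k + l + 1))]
    congr 2
    ext p q
    rw [matSingle_mul _ _ ⟨j, hj⟩, matSingle_apply]
    simp [h]

lemma entry_add (i j : ℕ) (x y : Stab A) : entry i j (x + y) = entry i j x + entry i j y :=
  Stab.ind₂ (p := fun x y => entry i j (x + y) = entry i j x + entry i j y) x y
    (isClosed_eq ((continuous_entry i j).comp continuous_add)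
      (((continuous_entry i j).comp continuous_fst).add
        ((continuous_entry i j).comp continuous_snd))) fun a b => by
      rw [← Stab.coe_add, entry_coe, entry_coe, entry_coe, map_add]

lemma entry_smul (i j : ℕ) (c : ℂ) (x : Stab A) : entry i j (c • x) = c • entry i j x :=
  Stab.ind (p := fun x => entry i j (c • x) = c • entry i j x) x
    (isClosed_eq ((continuous_entry i j).comp (continuous_const_smul c))
      ((continuous_entry i j).const_smul c)) fun a => by
      rw [← Stab.coe_smul, entry_coe, entry_coe, _root_.map_smul]

/-- The entry map as a continuous linear map. -/
noncomputable def entryL (i j : ℕ) : Stab A →L[ℂ] A where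
  toFun := entry i j
  map_add' := entry_add i j
  map_smul' := entry_smul i j
  cont := continuous_entry i j

lemma entryL_apply (i j : ℕ) (x : Stab A) : entryL i j x = entry i j x := rfl

lemma entry_star (i j : ℕ) (x : Stab A) : entry i j (star x) = star (entry j i x) := by
  refine Stab.ind_mat (p := fun x => entry i j (star x) = star (entry j i x)) (i + j + 1)
    (isClosed_eq ((continuous_entry i j).comp continuous_star) (continuous_entry j i).star) ?_ x
  intro n hn M
  rw [Stab.star_coe_ofMat, entry_mat (by omega) (by omega), entry_mat (by omega) (by omega),
    CStarMatrix.star_apply]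

lemma entry_single_same (i j : ℕ) (a : A) : entry i j (single i j a) = a := by
  have hi : i < i + j + 1 := by omega
  have hj : j < i + j + 1 := by omega
  rw [single_eq hi hj, entry_mat hi hj, matSingle_apply]
  simp

lemma entry_single_of_ne {i j k l : ℕ} (h : ¬ (i = k ∧ j = l)) (a : A) :
    entry i j (single k l a) = 0 := by
  have hi : i < i + j + k + l + 1 := by omega
  have hj : j < i + j + k + l + 1 := by omega
  have hk : k < i + j + k + l + 1 := by omega
  have hl : l < i + j + k + l + 1 := by omega
  rw [single_eq hk hl, entry_mat hi hj, matSingle_apply, if_neg h]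

lemma entry_star_mul_single_mul (i j : ℕ) (a : A) (x : Stab A) :
    entry i i (star x * single j j a * x) = star (entry j i x) * a * entry j i x := by
  refine Stab.ind_mat (p := fun x => entry i i (star x * single j j a * x) =
    star (entry j i x) * a * entry j i x) (i + j + 1)
    (isClosed_eq ((continuous_entry i i).comp (by fun_prop))
      (((continuous_entry j i).star.mul continuous_const).mul (continuous_entry j i))) ?_ x
  intro n hn M
  have hi : i < n := by omega
  have hj : j < n := by omega
  rw [single_eq hj hj, Stab.star_coe_ofMat, Stab.coe_ofMat_mul, Stab.coe_ofMat_mul,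
    entry_mat hi hi, entry_mat hj hi, mul_assoc, CStarMatrix.mul_apply,
    Finset.sum_eq_single ⟨j, hj⟩]
  · rw [matSingle_mul n j ⟨j, hj⟩, CStarMatrix.star_apply]
    simp [mul_assoc]
  · intro k _ hk
    rw [matSingle_mul n j ⟨j, hj⟩, if_neg (fun h => hk (Fin.ext h)), mul_zero]
  · simp

lemma entry_star_mul_self_nonneg (i : ℕ) (x : Stab A) : 0 ≤ entry i i (star x * x) := by
  refine Stab.ind_mat (p := fun x => 0 ≤ entry i i (star x * x)) (i + 1)
    (isClosed_le continuous_const ((continuous_entry i i).comp (by fun_prop))) ?_ x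
  intro n hn M
  rw [Stab.star_coe_ofMat, Stab.coe_ofMat_mul, entry_mat (by omega) (by omega),
    CStarMatrix.mul_apply]
  refine Finset.sum_nonneg fun k _ => ?_
  rw [CStarMatrix.star_apply]
  exact star_mul_self_nonneg _

lemma entry_mono (i : ℕ) {x y : Stab A} (h : x ≤ y) : entry i i x ≤ entry i i y := by
  obtain ⟨z, hz⟩ := CStarAlgebra.nonneg_iff_eq_star_mul_self.1 (sub_nonneg.2 h)
  have h1 := entry_star_mul_self_nonneg i z
  rw [← hz, ← entryL_apply, map_sub] at h1
  exact sub_nonneg.1 h1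

/-- The ⋆-homomorphism `a ↦ ∑_{j ∈ F} a ⊗ e_{jj}`. -/
noncomputable def diagHom (F : Finset ℕ) : A →⋆ₙₐ[ℂ] Stab A where
  toFun a := ∑ j ∈ F, single j j a
  map_smul' c a := by
    rw [MonoidHom.id_apply, Finset.smul_sum]
    exact Finset.sum_congr rfl fun j _ => single_smul j j c a
  map_zero' := Finset.sum_eq_zero fun j _ => single_zero j j
  map_add' a b := by
    rw [← Finset.sum_add_distrib]
    exact Finset.sum_congr rfl fun j _ => single_add j j a b
  map_mul' a b := by
    rw [Finset.sum_mul_sum]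
    refine Finset.sum_congr rfl fun j hj => ?_
    simp [single_mul_single, hj]
  map_star' a := by
    rw [star_sum]
    exact Finset.sum_congr rfl fun j _ => (star_single j j a).symm

lemma diagHom_apply (F : Finset ℕ) (a : A) : diagHom F a = ∑ j ∈ F, single j j a := rfl

lemma norm_diagHom_le (F : Finset ℕ) (a : A) : ‖diagHom F a‖ ≤ ‖a‖ :=
  NonUnitalStarAlgHom.norm_apply_le _ a

lemma diagHom_mul_single {F : Finset ℕ} {i : ℕ} (hi : i ∈ F) (j : ℕ) (a b : A) :
    diagHom F a * single i j b = single i j (a * b) := by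
  rw [diagHom_apply, Finset.sum_mul]
  simp [single_mul_single, hi]

lemma norm_single_le (i j : ℕ) (a : A) : ‖single i j a‖ ≤ ‖a‖ := by
  have h : star (single i j a) * single i j a = diagHom {j} (star a * a) := by
    rw [star_single, single_mul_single, if_pos rfl, diagHom_apply, Finset.sum_singleton]
  have h1 := norm_diagHom_le {j} (star a * a)
  rw [← h, CStarRing.norm_star_mul_self, CStarRing.norm_star_mul_self] at h1
  by_contra! hlt
  nlinarith [norm_nonneg a]

/-- `a ↦ a ⊗ e_{ij}` as a continuous linear map. -/
noncomputable def singleL (i j : ℕ) : A →L[ℂ] Stab A :=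
  LinearMap.mkContinuous
    { toFun := single i j
      map_add' := single_add i j
      map_smul' := single_smul i j } 1 fun a => by
    rw [one_mul]; exact norm_single_le i j a

lemma continuous_single (i j : ℕ) : Continuous (single (A := A) i j) :=
  (singleL i j).continuous

lemma single_mul_mul_single (i j k l : ℕ) (a b : A) (x : Stab A) :
    single i j a * x * single k l b = single i l (a * entry j k x * b) := by
  refine Stab.ind_mat (p := fun x => single i j a * x * single k l b =
    single i l (a * entry j k x * b)) (i + j + k + l + 1) ?_ ?_ x
  · refine isClosed_eq (by fun_prop) ((continuous_single i l).comp ?_)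
    exact (continuous_const.mul (continuous_entry j k)).mul continuous_const
  intro n hn M
  have hi : i < n := by omega
  have hj : j < n := by omega
  have hk : k < n := by omega
  have hl : l < n := by omega
  rw [single_eq hi hj, single_eq hk hl, single_eq hi hl, Stab.coe_ofMat_mul, Stab.coe_ofMat_mul,
    entry_mat hj hk]
  congr 2
  ext p q
  rw [mul_matSingle n ⟨k, hk⟩, matSingle_mul n i ⟨j, hj⟩, matSingle_apply]
  by_cases hp : (p : ℕ) = i <;> by_cases hq : (q : ℕ) = l <;> simp [hp, hq]

lemma coe_ofMat_eq_sum (n : ℕ) (M : Mat A n) :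
    Stab.coe (ofMat n M) = ∑ i : Fin n, ∑ j : Fin n, single i j (M i j) := by
  have h := congrArg (Stab.ofMatHom n) (sum_matSingle n M)
  simp only [map_sum] at h
  rw [show Stab.coe (ofMat n M) = Stab.ofMatHom n M from rfl, ← h]
  exact Finset.sum_congr rfl fun i _ => Finset.sum_congr rfl fun j _ =>
    (single_eq i.2 j.2 _).symm

/-- On a `k × k` matrix, once `n ≥ k`, this is entrywise convergence of `e n * a`; boundedness
extends it to the completion. -/
lemma tendsto_diagHom_mul {e : ℕ → A} (he : ∀ n, ‖e n‖ ≤ 1)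
    (hlim : ∀ a, Tendsto (fun n => e n * a) atTop (𝓝 a)) (x : Stab A) :
    Tendsto (fun n => diagHom (Finset.range n) (e n) * x) atTop (𝓝 x) := by
  refine Stab.ind (p := fun x => Tendsto (fun n => diagHom (Finset.range n) (e n) * x) atTop (𝓝 x))
    x ?_ ?_
  · exact isClosed_of_closure_subset fun x hx => tendsto_mul_of_mem_closure
      (fun n => (norm_diagHom_le _ _).trans (he n)) (fun y hy => hy) hx
  · intro y
    obtain ⟨k, M, rfl⟩ := MInf.exists₁ y
    rw [coe_ofMat_eq_sum]
    have h : Tendsto (fun n => ∑ i : Fin k, ∑ j : Fin k, single i j (e n * M i j)) atTop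
        (𝓝 (∑ i : Fin k, ∑ j : Fin k, single i j (M i j))) :=
      tendsto_finsetSum _ fun i _ => tendsto_finsetSum _ fun j _ =>
        ((continuous_single i j).tendsto _).comp (hlim _)
    refine h.congr' ?_
    filter_upwards [eventually_ge_atTop k] with n hn
    rw [Finset.mul_sum]
    refine Finset.sum_congr rfl fun i _ => ?_
    rw [Finset.mul_sum]
    refine Finset.sum_congr rfl fun j _ => ?_
    rw [diagHom_mul_single (Finset.mem_range.2 (i.2.trans_le hn))]

lemma tendsto_mul_diagHom {e : ℕ → A} (he : ∀ n, 0 ≤ e n ∧ ‖e n‖ ≤ 1)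
    (hlim : ∀ a, Tendsto (fun n => e n * a) atTop (𝓝 a)) (x : Stab A) :
    Tendsto (fun n => x * diagHom (Finset.range n) (e n)) atTop (𝓝 x) := by
  have h := (tendsto_diagHom_mul (fun n => (he n).2) hlim (star x)).star
  rw [star_star] at h
  refine h.congr fun n => ?_
  rw [star_mul, star_star, ← map_star, (IsSelfAdjoint.of_nonneg (he n).1).star_eq]

lemma diagHom_nonneg (F : Finset ℕ) {a : A} (ha : 0 ≤ a) : 0 ≤ diagHom F a := by
  obtain ⟨b, rfl⟩ := CStarAlgebra.nonneg_iff_eq_star_mul_self.1 ha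
  rw [map_mul, map_star]
  exact star_mul_self_nonneg _

lemma single_nonneg (i : ℕ) {a : A} (ha : 0 ≤ a) : 0 ≤ single i i a := by
  simpa [diagHom_apply] using diagHom_nonneg {i} ha

lemma isSigmaUnital_stab (hA : IsSigmaUnital A) : IsSigmaUnital (Stab A) := by
  obtain ⟨e, he, hlim⟩ := hA
  exact ⟨fun n => diagHom (Finset.range n) (e n),
    fun n => ⟨diagHom_nonneg _ (he n).1, (norm_diagHom_le _ _).trans (he n).2⟩,
    fun x => ⟨tendsto_diagHom_mul (fun n => (he n).2) (fun a => (hlim a).1) x,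
      tendsto_mul_diagHom he (fun a => (hlim a).1) x⟩⟩

/-- Cutting `x` on both sides by the diagonal approximate unit gives finite sums of terms `(e n
x_{ij} e m) ⊗ e_{ij}`, and two limits recover `x`. -/
lemma eq_zero_of_entry_eq_zero (hA : IsSigmaUnital A) {x : Stab A} (h : ∀ i j, entry i j x = 0) :
    x = 0 := by
  obtain ⟨e, he, hlim⟩ := hA
  have hz : ∀ n m, diagHom (Finset.range n) (e n) * x * diagHom (Finset.range m) (e m) = 0 := by
    intro n m
    simp only [diagHom_apply, Finset.sum_mul, Finset.mul_sum, single_mul_mul_single, h]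
    simp [single_zero]
  have h1 : ∀ n, diagHom (Finset.range n) (e n) * x = 0 := fun n => by
    have := tendsto_mul_diagHom he (fun a => (hlim a).1) (diagHom (Finset.range n) (e n) * x)
    simp only [hz] at this
    exact tendsto_nhds_unique this tendsto_const_nhds
  have := tendsto_diagHom_mul (fun n => (he n).2) (fun a => (hlim a).1) x
  simp only [h1] at this
  exact tendsto_nhds_unique this tendsto_const_nhds

lemma isSimple_stab (hA : IsSimple A) (hσ : IsSigmaUnital A) : IsSimple (Stab A) := by
  obtain ⟨hnt, hid⟩ := hA
  refine ⟨?_, fun I hI hmul => ?_⟩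
  · obtain ⟨a, ha⟩ := exists_ne (0 : A)
    refine ⟨single 0 0 a, 0, fun h => ha ?_⟩
    rw [← entry_single_same 0 0 a, h, ← entryL_apply, map_zero]
  · by_cases hbot : I = ⊥
    · exact Or.inl hbot
    right
    obtain ⟨x, hxI, hx⟩ := I.exists_mem_ne_zero_of_ne_bot hbot
    have hcl : ∀ a b y, y ∈ I → a * y * b ∈ I := fun a b y hy => (hmul b _ (hmul a y hy).1).2
    obtain ⟨i, j, hij⟩ : ∃ i j, entry i j x ≠ 0 := by
      by_contra! h
      exact hx (eq_zero_of_entry_eq_zero hσ h)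
    -- The trace of `I` on the corner is a closed ideal of `A`. For a nonzero entry `b` of some `x ∈
    -- I` it contains `b⋆ b b⋆ ≠ 0`, so it is everything.
    have hJ : I.comap (singleL 0 0 : A →L[ℂ] Stab A).toLinearMap = ⊤ := by
      refine (hid _ (hI.preimage (continuous_single 0 0)) fun a y hy => ?_).resolve_left fun h => ?_
      · have hy' : single 0 0 y ∈ I := hy
        refine ⟨?_, ?_⟩
        · have h1 := (hmul (single 0 0 a) _ hy').1
          rwa [single_mul_single, if_pos rfl] at h1
        · have h1 := (hmul (single 0 0 a) _ hy').2
          rwa [single_mul_single, if_pos rfl] at h1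
      · have h1 := hcl (single 0 i (star (entry i j x))) (single j 0 (star (entry i j x))) x hxI
        rw [single_mul_mul_single] at h1
        have h2 : star (entry i j x) * entry i j x * star (entry i j x) ∈
            I.comap (singleL 0 0 : A →L[ℂ] Stab A).toLinearMap := h1
        rw [h, Submodule.mem_bot] at h2
        have h3 := mul_star_mul_self_ne_zero (star_ne_zero.2 hij)
        rw [star_star] at h3
        exact h3 h2
    have h00 : ∀ a : A, single 0 0 a ∈ I := fun a => by
      have : a ∈ I.comap (singleL 0 0 : A →L[ℂ] Stab A).toLinearMap := by rw [hJ]; trivial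
      exact this
    have h3 : ∀ i j (a b c : A), single i j (a * b * c) ∈ I := fun i j a b c => by
      have := hcl (single i 0 a) (single 0 j c) _ (h00 b)
      rwa [single_mul_single, if_pos rfl, single_mul_single, if_pos rfl] at this
    -- The matrix units `1 ⊗ e_{ij}` are not in the algebra, so moving the corner to position `(i,
    -- j)` costs a factor on each side; the approximate unit removes them one at a time.
    obtain ⟨e, he, hlim⟩ := hσ
    have h2 : ∀ i j (b c : A), single i j (b * c) ∈ I := fun i j b c => by
      refine hI.mem_of_tendsto (((continuous_single i j).tendsto _).comp
        ((hlim (b * c)).1)) (Eventually.of_forall fun n => ?_)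
      have := h3 i j (e n) b c
      rwa [mul_assoc] at this
    have h1 : ∀ i j (b : A), single i j b ∈ I := fun i j b =>
      hI.mem_of_tendsto (((continuous_single i j).tendsto _).comp ((hlim b).1))
        (Eventually.of_forall fun n => h2 i j (e n) b)
    refine eq_top_iff.2 fun y _ => ?_
    refine Stab.ind (p := fun y => y ∈ I) y hI fun z => ?_
    obtain ⟨n, M, rfl⟩ := MInf.exists₁ z
    rw [coe_ofMat_eq_sum]
    exact I.sum_mem fun i _ => I.sum_mem fun j _ => h1 _ _ _

/-- Formally `(x⋆ x)_{ii} = ∑ x_{ji}⋆ x_{ji}`. Inserting the diagonal contraction with entries `e n`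
between `x⋆` and `x` gives finite sums `∑ x_{ji}⋆ e n x_{ji}`, which bound the partial sums from
below and, for a fixed finite set of rows, converge to the partial sum, bounding it by `(x⋆
x)_{ii}`. -/
lemma isEntryFamily_entryL (hσ : IsSigmaUnital A) :
    IsEntryFamily (fun i j : ℕ => (entryL i j : Stab A →L[ℂ] A)) := by
  refine ⟨fun i j x => entry_star i j x, fun i x => ?_⟩
  obtain ⟨e, he, hlim⟩ := hσ
  simp only [entryL_apply]
  have hdiag : ∀ (F : Finset ℕ) n, ∑ j ∈ F, star (entry j i x) * e n * entry j i x =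
      entry i i (star x * diagHom F (e n) * x) := fun F n => by
    rw [diagHom_apply, Finset.mul_sum, Finset.sum_mul, ← entryL_apply, map_sum]
    exact Finset.sum_congr rfl fun j _ => (entry_star_mul_single_mul i j (e n) x).symm
  have hdle : ∀ (F : Finset ℕ) n, entry i i (star x * diagHom F (e n) * x) ≤
      entry i i (star x * x) := fun F n => entry_mono i
    (star_mul_mul_le_of_norm_le_one (diagHom_nonneg F (he n).1)
      ((norm_diagHom_le _ _).trans (he n).2) x)
  have hle : ∀ F : Finset ℕ, ∑ j ∈ F, star (entry j i x) * entry j i x ≤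
      entry i i (star x * x) := fun F => by
    have ht : Tendsto (fun n => ∑ j ∈ F, star (entry j i x) * e n * entry j i x) atTop
        (𝓝 (∑ j ∈ F, star (entry j i x) * entry j i x)) :=
      tendsto_finsetSum _ fun j _ => ((hlim _).2).mul_const _
    refine le_of_tendsto ht (Eventually.of_forall fun n => ?_)
    rw [hdiag]
    exact hdle F n
  refine hasSum_of_sum_le_of_tendsto (fun j => star_mul_self_nonneg _) hle Finset.range ?_
  have hlow : ∀ n, entry i i (star x * diagHom (Finset.range n) (e n) * x) ≤
      ∑ j ∈ Finset.range n, star (entry j i x) * entry j i x := fun n => by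
    rw [← hdiag]
    exact Finset.sum_le_sum fun j _ => star_mul_mul_le_of_norm_le_one (he n).1 (he n).2 _
  have ht : Tendsto (fun n => entry i i (star x * x) -
      entry i i (star x * diagHom (Finset.range n) (e n) * x)) atTop (𝓝 0) := by
    have h1 := tendsto_mul_diagHom he (fun a => (hlim a).1) (star x)
    have h2 := ((continuous_entry i i).tendsto _).comp (h1.mul_const x)
    simpa using h2.const_sub (entry i i (star x * x))
  have hs : Tendsto (fun n => entry i i (star x * x) -
      ∑ j ∈ Finset.range n, star (entry j i x) * entry j i x) atTop (𝓝 0) :=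
    squeeze_zero_norm (fun n => CStarAlgebra.norm_le_norm_of_nonneg_of_le
      (sub_nonneg.2 (hle _)) (sub_le_sub_left (hlow n) _)) (by simpa using ht.norm)
  simpa using hs.const_sub (entry i i (star x * x))

/-- The trace `τ̂` on `A ⊗ 𝕂`. -/
noncomputable def hatTrace (hσ : IsSigmaUnital A) (τ : PosTrace A) (hτ : τ.IsLSC) :
    PosTrace (Stab A) :=
  matTrace τ hτ (isEntryFamily_entryL hσ)

lemma hatTrace_apply (hσ : IsSigmaUnital A) (τ : PosTrace A) (hτ : τ.IsLSC) (x : Stab A) :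
    (hatTrace hσ τ hτ).toFun x = τ.hat x := rfl

lemma hatTrace_isLSC (hσ : IsSigmaUnital A) (τ : PosTrace A) (hτ : τ.IsLSC) :
    (hatTrace hσ τ hτ).IsLSC :=
  matTrace_isLSC τ hτ _

lemma hat_single (τ : PosTrace A) (a : A) : τ.hat (single 0 0 a) = τ.toFun a := by
  rw [PosTrace.hat, tsum_eq_single 0, entry_single_same]
  intro i hi
  rw [entry_single_of_ne (by simp [hi]), τ.map_zero]

/-- The restriction of a trace on `A ⊗ 𝕂` to the corner `A`. -/
noncomputable def cornerTrace (σ : PosTrace (Stab A)) : PosTrace A where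
  toFun a := σ.toFun (single 0 0 a)
  map_zero := by rw [single_zero, σ.map_zero]
  map_add a b ha hb := by
    rw [single_add, σ.map_add _ _ (single_nonneg 0 ha) (single_nonneg 0 hb)]
  map_smul c a ha := by rw [single_smul, σ.map_smul _ _ (single_nonneg 0 ha)]
  map_star_mul_self a := by
    have := σ.map_star_mul_self (single 0 0 a)
    rwa [star_single, single_mul_single, if_pos rfl, single_mul_single, if_pos rfl] at this

lemma cornerTrace_isLSC {σ : PosTrace (Stab A)} (hσ : σ.IsLSC) : (cornerTrace σ).IsLSC := by
  change LowerSemicontinuousOn (fun a => σ.toFun (single 0 0 a)) {a : A | 0 ≤ a}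
  exact LowerSemicontinuousOn.comp hσ (continuous_single 0 0).continuousOn fun _ ha =>
    single_nonneg 0 ha

end MatrixUnits

/-! ### Hereditary subalgebras generated by a positive element -/

section Hereditary

variable {D : Type u} [NonUnitalCStarAlgebra D] [PartialOrder D] [StarOrderedRing D]

instance isClosed_her (h : D) (hh : 0 ≤ h) : IsClosed (her h hh : Set D) :=
  NonUnitalStarSubalgebra.isClosed_topologicalClosure _

variable {h : D} {hh : 0 ≤ h}

lemma mul_mul_mem_her (x : D) : h * x * h ∈ her h hh := by
  rw [← SetLike.mem_coe, coe_her]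
  exact subset_closure ⟨x, rfl⟩

lemma mul_mul_mem_her_of_mem {y y' : D} (hy : y ∈ her h hh) (x : D) (hy' : y' ∈ her h hh) :
    y * x * y' ∈ her h hh := by
  have hcl := (isClosed_her h hh).closure_eq
  have h1 : ∀ z : D, h * z * h * x * y' ∈ her h hh := fun z => by
    rw [← SetLike.mem_coe, ← hcl]
    refine map_mem_closure (f := fun y' => h * z * h * x * y') (by fun_prop) hy' ?_
    rintro _ ⟨w, rfl⟩
    have := mul_mul_mem_her (h := h) (hh := hh) (z * h * x * h * w)
    simpa only [mul_assoc, SetLike.mem_coe] using this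
  rw [← SetLike.mem_coe, ← hcl]
  refine map_mem_closure (f := fun y => y * x * y') (by fun_prop) hy ?_
  rintro _ ⟨w, rfl⟩
  exact h1 w

lemma mul_mem_her (x : D) {y : D} (hy : y ∈ her h hh) : h * x * y ∈ her h hh := by
  rw [← SetLike.mem_coe, ← (isClosed_her h hh).closure_eq]
  refine map_mem_closure (f := fun y => h * x * y) (by fun_prop) hy ?_
  rintro _ ⟨w, rfl⟩
  have := mul_mul_mem_her (h := h) (hh := hh) (x * h * w)
  simpa only [mul_assoc, SetLike.mem_coe] using this

lemma cfcn_mem_her (f : ℝ → ℝ) {x : D} (hx : x ∈ her h hh) : cfcₙ f x ∈ her h hh :=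
  cfcₙ_mem (𝕜' := ℂ) f hx

lemma nnrpow_mem_her (r : ℝ≥0) {x : D} (hx0 : 0 ≤ x) (hx : x ∈ her h hh) : x ^ r ∈ her h hh := by
  rw [CFC.nnrpow_eq_cfcₙ_real x r]
  exact cfcn_mem_her _ hx

lemma sqrt_mem_her {x : D} (hx0 : 0 ≤ x) (hx : x ∈ her h hh) : CFC.sqrt x ∈ her h hh := by
  rw [CFC.sqrt_eq_nnrpow]
  exact nnrpow_mem_her _ hx0 hx

/-- The element `h³ = h h h` has the required form, and `h` is its cube root. -/
lemma self_mem_her : h ∈ her h hh := by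
  have h3 : h ^ (3 : ℝ≥0) ∈ her h hh := by
    rw [CFC.nnrpow_three h]
    exact mul_mul_mem_her h
  have := nnrpow_mem_her (3⁻¹) CFC.nnrpow_nonneg h3
  rwa [CFC.nnrpow_nnrpow_inv h (by norm_num)] at this

lemma her_le_her {k : D} {hk : 0 ≤ k} (hkh : k ∈ her h hh) : her k hk ≤ her h hh := by
  intro x hx
  have hx' : x ∈ closure (Set.range fun x => k * x * k) := by
    rw [← coe_her k hk]; exact hx
  refine closure_minimal ?_ (isClosed_her h hh) hx'
  rintro _ ⟨w, rfl⟩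
  exact mul_mul_mem_her_of_mem hkh w hkh

/-- If `x D y = 0`, then `x` annihilates the dense ideal generated by `y`, so `x x⋆ = 0`. -/
lemma exists_mul_mul_ne_zero (hD : IsSimple D) {x y : D} (hx : x ≠ 0) (hy : y ≠ 0) :
    ∃ z, x * z * y ≠ 0 := by
  by_contra! hxy
  have hcl : IsClosed {v : D | x * v = 0} := isClosed_eq (by fun_prop) continuous_const
  have hsub : (Submodule.span ℂ {a : D | ∃ p q, a = p * y * q} : Set D) ⊆ {v : D | x * v = 0} := by
    intro v hv
    induction hv using Submodule.span_induction with
    | mem a ha =>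
      obtain ⟨p, q, rfl⟩ := ha
      change x * (p * y * q) = 0
      rw [← mul_assoc, ← mul_assoc, hxy, zero_mul]
    | zero => exact mul_zero x
    | add v w _ _ hv hw =>
      change x * (v + w) = 0
      rw [mul_add, hv, hw, add_zero]
    | smul c v _ hv =>
      change x * (c • v) = 0
      rw [mul_smul_comm, hv, smul_zero]
  have hall := (dense_span_mul_mul hD hy).mono hsub (star x)
  rw [hcl.closure_eq] at hall
  exact hx ((CStarRing.mul_star_self_eq_zero_iff x).1 hall)

end Hereditary

/-! ### Extending a trace from a hereditary subalgebra -/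

section Extension

variable {D : Type u} [NonUnitalCStarAlgebra D] [PartialOrder D] [StarOrderedRing D]

/-- The squares `(v i d)⋆ (v i d)` add up to `d⋆ d` and have the same trace as `(v i d)(v i d)⋆`. So
when every `v i` lies in `bD`, a lower semicontinuous trace is determined by its values on `b D b⋆`.
-/
lemma IsQuasiBasis.trace_eq {ι : Type*} {v : ι → D} (hv : IsQuasiBasis v) {σ : PosTrace D}
    (hσ : σ.IsLSC) (d : D) :
    σ.toFun (star d * d) = ∑' i, σ.toFun (v i * (d * star d) * star (v i)) := by
  rw [hσ.hasSum (fun i => star_mul_self_nonneg _) (hv d)]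
  refine tsum_congr fun i => ?_
  rw [σ.map_star_mul_self, star_mul]
  simp only [mul_assoc]

variable {h : D} {hh : 0 ≤ h} {ι : Type v} {v : ι → D}

/-- The compression `x ↦ ψ (v i * x * star (v j))`. -/
noncomputable def compress (ψ : her h hh →⋆ₙₐ[ℂ] D) (v : ι → D)
    (hv : ∀ i j x, v i * x * star (v j) ∈ her h hh) (i j : ι) : D →L[ℂ] D :=
  LinearMap.mkContinuous
    { toFun := fun x => ψ ⟨v i * x * star (v j), hv i j x⟩
      map_add' := fun x y => by
        rw [← map_add]
        congr 1
        ext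
        simp [mul_add, add_mul]
      map_smul' := fun c x => by
        rw [RingHom.id_apply, ← _root_.map_smul]
        congr 1
        ext
        simp [mul_smul_comm, smul_mul_assoc] }
    (‖v i‖ * ‖v j‖) fun x => by
      refine (NonUnitalStarAlgHom.norm_apply_le ψ _).trans ?_
      change ‖v i * x * star (v j)‖ ≤ _
      refine (norm_mul_le _ _).trans ?_
      rw [norm_star, mul_right_comm]
      gcongr
      exact norm_mul_le _ _

lemma compress_apply (ψ : her h hh →⋆ₙₐ[ℂ] D) (hv : ∀ i j x, v i * x * star (v j) ∈ her h hh)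
    (i j : ι) (x : D) : compress ψ v hv i j x = ψ ⟨v i * x * star (v j), hv i j x⟩ := rfl

lemma hasSum_map_her (ψ : her h hh →⋆ₙₐ[ℂ] D) {f : ι → her h hh} {x : her h hh}
    (hf : HasSum (fun i => (f i : D)) x) : HasSum (fun i => ψ (f i)) (ψ x) := by
  have h1 : HasSum f x := (Topology.IsInducing.subtypeVal.hasSum_iff
    (g := (NonUnitalStarSubalgebraClass.subtype (her h hh))) (f := f) (a := x)).1 hf
  exact h1.map ψ (AddMonoidHomClass.continuous_of_bound ψ 1 fun y => by
    rw [one_mul]; exact NonUnitalStarAlgHom.norm_apply_le ψ y)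

lemma isEntryFamily_compress (hqb : IsQuasiBasis v) (ψ : her h hh →⋆ₙₐ[ℂ] D)
    (hv : ∀ i j x, v i * x * star (v j) ∈ her h hh) :
    IsEntryFamily (compress ψ v hv) := by
  refine ⟨fun i j x => ?_, fun i x => ?_⟩
  · rw [compress_apply, compress_apply, ← map_star]
    congr 1
    ext
    simp [mul_assoc]
  · have h1 : ∀ j, star (compress ψ v hv j i x) * compress ψ v hv j i x =
        ψ (star ⟨v j * x * star (v i), hv j i x⟩ * ⟨v j * x * star (v i), hv j i x⟩) :=
      fun j => by rw [compress_apply, map_mul, map_star]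
    simp only [h1]
    refine hasSum_map_her ψ ?_
    convert hqb (x * star (v i)) using 1
    · ext j
      simp [mul_assoc]
    · simp [mul_assoc]

/-- The sum of `τ (ψ (v i d d⋆ v i⋆))` equals that of `τ (ψ (d⋆ v i⋆ v i d))` by the trace property
in the target, and the latter adds up to `τ (ψ (d⋆ d))`. So the trace built from the compressions
extends `τ ∘ ψ`. -/
lemma matTrace_compress_apply (hqb : IsQuasiBasis v) (ψ : her h hh →⋆ₙₐ[ℂ] D)
    (hv : ∀ i j x, v i * x * star (v j) ∈ her h hh)
    (hv' : ∀ i, ∀ x ∈ her h hh, v i * x ∈ her h hh)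
    (τ : PosTrace D) (hτ : τ.IsLSC) (d : her h hh) :
    (matTrace τ hτ (isEntryFamily_compress hqb ψ hv)).toFun (d * star (d : D)) =
      τ.toFun (ψ (star d * d)) := by
  have h1 : HasSum (fun i => ψ (star ⟨v i * d, hv' i d d.2⟩ * ⟨v i * d, hv' i d d.2⟩))
      (ψ (star d * d)) := hasSum_map_her ψ (hqb (d : D))
  have h2 : ∀ i, 0 ≤ ψ (star ⟨v i * d, hv' i d d.2⟩ * ⟨v i * d, hv' i d d.2⟩) := fun i => by
    rw [map_mul, map_star]
    exact star_mul_self_nonneg _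
  rw [hτ.hasSum h2 h1, matTrace_apply]
  refine tsum_congr fun i => ?_
  rw [map_mul ψ, map_star ψ, τ.map_star_mul_self, ← map_star ψ, ← map_mul ψ, compress_apply]
  congr 2
  ext
  simp [mul_assoc]

end Extension

/-! ### Isomorphisms scale the trace -/

section Scaling

variable {A : Type u} [NonUnitalCStarAlgebra A] [PartialOrder A] [StarOrderedRing A]

lemma single_ne_zero {a : A} (ha : a ≠ 0) : single 0 0 a ≠ 0 := fun h => ha <| by
  rw [← entry_single_same 0 0 a, h, ← entryL_apply, map_zero]

lemma exists_single_conj {a : A} (x : Stab A) (hx : 0 ≤ x) :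
    ∃ p : A, 0 ≤ p ∧ single 0 0 a * x * star (single 0 0 a) = single 0 0 p := by
  refine ⟨a * entry 0 0 x * star a, star_right_conjugate_nonneg ?_ a, ?_⟩
  · have := entry_mono 0 hx
    rwa [← entryL_apply, map_zero] at this
  · rw [star_single, single_mul_mul_single]

lemma PosTrace.IsDenselyDefined.exists_finite {τ : PosTrace A} (hτ : τ.IsDenselyDefined)
    (hA : IsSimple A) : ∃ a : A, 0 ≤ a ∧ a ≠ 0 ∧ τ.toFun a < ∞ := by
  by_contra! hno
  obtain ⟨x, hx⟩ := (@exists_ne A hA.1 0)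
  have hsub : Submodule.span ℂ {a : A | 0 ≤ a ∧ τ.toFun a < ∞} = ⊥ := by
    rw [Submodule.span_eq_bot]
    rintro a ⟨ha, hat⟩
    by_contra h0
    exact absurd hat (not_lt.2 (hno a ha h0))
  have h1 := hτ x
  rw [hsub, Submodule.bot_coe, closure_singleton] at h1
  exact hx h1

/-- With `s = √a ⊗ e₀₀` and `τ a < ∞`, the element `(s c h)⋆ (s c h)` lies in `h D h` and inherits
finiteness from `s⋆ s`; simplicity provides a `c` that makes it nonzero. -/
lemma exists_finite_mem_her (hA : IsSimple A) (hσ : IsSigmaUnital A) {τ : PosTrace A}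
    (hd : τ.IsDenselyDefined) (hl : τ.IsLSC) {h : Stab A} (hh : 0 ≤ h) (h0 : h ≠ 0) :
    ∃ y : Stab A, y ∈ her h hh ∧ y ≠ 0 ∧ 0 ≤ y ∧ τ.hat y < ∞ ∧ τ.hat (star y * y) < ∞ := by
  obtain ⟨a, ha, ha0, hat⟩ := hd.exists_finite hA
  have hs0 : CFC.sqrt a ≠ 0 := fun h => ha0 ((CFC.sqrt_eq_zero_iff a).1 h)
  obtain ⟨c, hc⟩ := exists_mul_mul_ne_zero (isSimple_stab hA hσ) (single_ne_zero hs0) h0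
  set s := single 0 0 (CFC.sqrt a) with hs
  have hss : star s * s = single 0 0 a := by
    rw [hs, star_single, single_mul_single, if_pos rfl,
      (IsSelfAdjoint.of_nonneg (CFC.sqrt_nonneg a)).star_eq, CFC.sqrt_mul_sqrt_self a ha]
  set T := hatTrace hσ τ hl
  have hfin : T.toFun (star (s * c * h) * (s * c * h)) < ∞ := by
    rw [mul_assoc s c h]
    refine (PosTrace.apply_star_mul_right_le _ _).trans_lt (ENNReal.mul_lt_top (by simp) ?_)
    rw [hss, hatTrace_apply, hat_single]
    exact hat
  refine ⟨star (s * c * h) * (s * c * h), ?_, ?_, star_mul_self_nonneg _, hfin, ?_⟩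
  · have := mul_mul_mem_her (h := h) (hh := hh) (star c * star s * s * c)
    rw [star_mul, star_mul, (IsSelfAdjoint.of_nonneg hh).star_eq]
    simpa only [mul_assoc] using this
  · rwa [Ne, CStarRing.star_mul_self_eq_zero_iff]
  · exact (PosTrace.apply_star_mul_left_le (τ := T) _ _).trans_lt
      (ENNReal.mul_lt_top (by simp) hfin)

lemma hat_faithful (hA : IsSimple A) (hσ : IsSigmaUnital A) {τ : PosTrace A}
    (hτ : τ.IsUniqueTrace) {x : Stab A} (hx : τ.hat (star x * x) = 0) : x = 0 := by
  obtain ⟨-, hl, ⟨a, ha, hat⟩, -⟩ := hτ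
  refine (hatTrace_isLSC hσ τ hl).faithful (isSimple_stab hA hσ) (single_nonneg 0 ha) ?_ hx
  rwa [hatTrace_apply, hat_single]

/-- A lower semicontinuous trace on `A ⊗ 𝕂` that is finite on some `star y * y`, `y ≠ 0`, is a
multiple of `τ̂`. -/
lemma exists_eq_mul_hat (hA : IsSimple A) (hσ : IsSigmaUnital A) {τ : PosTrace A}
    (hτ : τ.IsUniqueTrace) {σ : PosTrace (Stab A)} (hl : σ.IsLSC) {y : Stab A} (hy : y ≠ 0)
    (hfin : σ.toFun (star y * y) < ∞) :
    ∃ c : ℝ≥0, ∀ x : Stab A, 0 ≤ x → σ.toFun x = c * τ.hat x := by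
  obtain ⟨hd, hτl, -, huniq⟩ := hτ
  have hS := isSimple_stab hA hσ
  obtain ⟨a, ha⟩ := @exists_ne A hA.1 0
  have hsa := single_ne_zero ha
  have hdense : (cornerTrace σ).IsDenselyDefined := by
    -- With `x = (a ⊗ e₀₀) c y ≠ 0`, the element `x x⋆` lies in the corner and has the trace of `x⋆
    -- x`, which is at most a multiple of that of `y⋆ y`. One such element suffices as `A` is
    -- simple.
    obtain ⟨c, hc⟩ := exists_mul_mul_ne_zero hS hsa hy
    obtain ⟨p, hp, hps⟩ := exists_single_conj (a := a) (c * y * star (c * y))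
      (mul_star_self_nonneg _)
    have hz : single 0 0 p = single 0 0 a * c * y * star (single 0 0 a * c * y) := by
      rw [← hps]
      simp only [star_mul, mul_assoc]
    have hp0 : p ≠ 0 := by
      rintro rfl
      rw [single_zero] at hz
      exact hc ((CStarRing.mul_star_self_eq_zero_iff _).1 hz.symm)
    have hsp : star (CFC.sqrt p) * CFC.sqrt p = p := by
      rw [(IsSelfAdjoint.of_nonneg (CFC.sqrt_nonneg p)).star_eq, CFC.sqrt_mul_sqrt_self p hp]
    refine PosTrace.isDenselyDefined_of_simple hA
      (x := CFC.sqrt p) (fun h => hp0 ((CFC.sqrt_eq_zero_iff p).1 h)) ?_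
    rw [hsp]
    change σ.toFun (single 0 0 p) < ∞
    rw [hz, ← σ.map_star_mul_self]
    exact (PosTrace.apply_star_mul_left_le _ _).trans_lt (ENNReal.mul_lt_top (by simp) hfin)
  obtain ⟨c, hc⟩ := huniq (cornerTrace σ) hdense (cornerTrace_isLSC hl)
  refine ⟨c, fun x hx => ?_⟩
  obtain ⟨d, rfl⟩ := CStarAlgebra.nonneg_iff_eq_star_mul_self.1 hx
  -- Choosing the quasi-basis in `(a ⊗ e₀₀) D` puts every `v i * x * star (v i)` into the corner,
  -- where the proportionality is known.
  obtain ⟨K, v, hvb, hv⟩ := exists_isQuasiBasis hS (isSigmaUnital_stab hσ) hsa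
  rw [hv.trace_eq hl d, ← hatTrace_apply hσ τ hτl, hv.trace_eq (hatTrace_isLSC hσ τ hτl) d,
    ← ENNReal.tsum_mul_left]
  refine tsum_congr fun i => ?_
  obtain ⟨z, hz⟩ := hvb i
  obtain ⟨p, hp, hps⟩ := exists_single_conj (a := a) (z * (d * star d) * star z)
    (star_right_conjugate_nonneg (mul_star_self_nonneg d) z)
  have h1 : v i * (d * star d) * star (v i) = single 0 0 p := by
    rw [← hps, hz]
    simp only [star_mul, mul_assoc]
  rw [h1, hatTrace_apply, hat_single]
  exact hc p hp

theorem exists_scaling (hA : IsSimple A) (hσ : IsSigmaUnital A) {τ : PosTrace A}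
    (hτ : τ.IsUniqueTrace) {h₁ h₂ : Stab A} {p₁ : 0 ≤ h₁} {p₂ : 0 ≤ h₂} (n₁ : h₁ ≠ 0)
    (n₂ : h₂ ≠ 0) (φ : her h₁ p₁ ≃⋆ₐ[ℂ] her h₂ p₂) :
    ∃ c : ℝ≥0, c ≠ 0 ∧ ∀ x : her h₁ p₁, 0 ≤ (x : Stab A) →
      τ.hat (φ x : Stab A) = c * τ.hat (x : Stab A) := by
  have hτl := hτ.2.1
  let ψ : her h₁ p₁ →⋆ₙₐ[ℂ] Stab A :=
    (NonUnitalStarSubalgebraClass.subtype (her h₂ p₂)).comp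
      (φ : her h₁ p₁ →⋆ₙₐ[ℂ] her h₂ p₂)
  have hψ : ∀ x, ψ x = (φ x : Stab A) := fun x => rfl
  obtain ⟨K, v, hvb, hqb⟩ := exists_isQuasiBasis (isSimple_stab hA hσ) (isSigmaUnital_stab hσ) n₁
  have hv : ∀ i j x, v i * x * star (v j) ∈ her h₁ p₁ := fun i j x => by
    obtain ⟨z, hz⟩ := hvb i
    obtain ⟨w, hw⟩ := hvb j
    have := mul_mul_mem_her (h := h₁) (hh := p₁) (z * x * star w)
    rw [hz, hw, star_mul, (IsSelfAdjoint.of_nonneg p₁).star_eq]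
    simpa only [mul_assoc] using this
  have hv' : ∀ i, ∀ x ∈ her h₁ p₁, v i * x ∈ her h₁ p₁ := fun i x hx => by
    obtain ⟨z, hz⟩ := hvb i
    rw [hz]
    exact mul_mem_her z hx
  set T := hatTrace hσ τ hτl with hT
  have hTl : T.IsLSC := hatTrace_isLSC hσ τ hτl
  set σ := matTrace T hTl (isEntryFamily_compress hqb ψ hv) with hσdef
  have hσT : ∀ d : her h₁ p₁, σ.toFun (d * star (d : Stab A)) = τ.hat (φ (star d * d) : Stab A) :=
    fun d => matTrace_compress_apply hqb ψ hv hv' T hTl d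
  obtain ⟨y, hyh, hy0, -, -, hyf⟩ := exists_finite_mem_her hA hσ hτ.1 hτl p₂ n₂
  set d : her h₁ p₁ := φ.symm ⟨y, hyh⟩ with hd
  have hφd : φ d = ⟨y, hyh⟩ := φ.apply_symm_apply _
  have hd0 : (d : Stab A) ≠ 0 := fun h => by
    have h1 : d = 0 := Subtype.ext h
    rw [h1, map_zero] at hφd
    exact hy0 (congrArg Subtype.val hφd).symm
  have hφdd : (φ (star d * d) : Stab A) = star y * y := by
    rw [map_mul, map_star, hφd]; rfl
  obtain ⟨c, hc⟩ := exists_eq_mul_hat hA hσ hτ (matTrace_isLSC T hTl _) (σ := σ)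
    (y := star (d : Stab A)) (star_ne_zero.2 hd0) (by
      rw [star_star, hσT, hφdd]; exact hyf)
  have hscale : ∀ x : her h₁ p₁, 0 ≤ (x : Stab A) →
      τ.hat (φ x : Stab A) = c * τ.hat (x : Stab A) := fun x hx => by
    let s : her h₁ p₁ := ⟨CFC.sqrt (x : Stab A), sqrt_mem_her hx x.2⟩
    have hstar : star (CFC.sqrt (x : Stab A)) = CFC.sqrt (x : Stab A) :=
      (IsSelfAdjoint.of_nonneg (CFC.sqrt_nonneg _)).star_eq
    have hss : star s * s = x := Subtype.ext <| by
      change star (CFC.sqrt (x : Stab A)) * CFC.sqrt (x : Stab A) = x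
      rw [hstar, CFC.sqrt_mul_sqrt_self _ hx]
    have hss' : (s : Stab A) * star (s : Stab A) = x := by
      change CFC.sqrt (x : Stab A) * star (CFC.sqrt (x : Stab A)) = x
      rw [hstar, CFC.sqrt_mul_sqrt_self _ hx]
    have h1 := hσT s
    rw [hss, hss', hc _ hx] at h1
    exact h1.symm
  refine ⟨c, ?_, hscale⟩
  -- For `c = 0` the nonzero element `y` would satisfy `τ̂ (y⋆ y) = 0`, against faithfulness.
  rintro rfl
  have h1 := hscale (star d * d) (star_mul_self_nonneg (d : Stab A))
  rw [hφdd, ENNReal.coe_zero, zero_mul] at h1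
  exact hy0 (hat_faithful hA hσ hτ h1)

end Scaling

/-! ### Restricting and producing isomorphisms of hereditary subalgebras -/

section HereditaryIso

variable {D : Type u} [NonUnitalCStarAlgebra D] [PartialOrder D] [StarOrderedRing D]

lemma star_sqrt (x : D) : star (CFC.sqrt x) = CFC.sqrt x :=
  (IsSelfAdjoint.of_nonneg (CFC.sqrt_nonneg x)).star_eq

variable {h k h' k' : D} {hh : 0 ≤ h} {hk : 0 ≤ k} {hh' : 0 ≤ h'} {hk' : 0 ≤ k'}

lemma map_nonneg_her (φ : her h hh ≃⋆ₐ[ℂ] her h' hh') {x : her h hh} (hx : 0 ≤ (x : D)) :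
    0 ≤ (φ x : D) := by
  let s : her h hh := ⟨CFC.sqrt (x : D), sqrt_mem_her hx x.2⟩
  have hs : star s * s = x := Subtype.ext <| by
    change star (CFC.sqrt (x : D)) * CFC.sqrt (x : D) = x
    rw [star_sqrt, CFC.sqrt_mul_sqrt_self _ hx]
  rw [← hs, map_mul, map_star]
  exact star_mul_self_nonneg (φ s : D)

/-- In `k z k` the element `z` need not lie in the domain of `φ`, so it is written `√k (√k z √k)
√k`. Since `φ √k` is a positive square root of `k'`, it lies in `her k'`, and continuity reaches the
closure. -/
lemma map_mem_her (φ : her h hh ≃⋆ₐ[ℂ] her h' hh') (hkh : k ∈ her h hh)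
    (e : (φ ⟨k, hkh⟩ : D) = k') {x : D} (hx : x ∈ her k hk) (hxh : x ∈ her h hh) :
    (φ ⟨x, hxh⟩ : D) ∈ her k' hk' := by
  have hs : CFC.sqrt k ∈ her h hh := sqrt_mem_her hk hkh
  set t : D := (φ ⟨CFC.sqrt k, hs⟩ : D) with ht
  have ht0 : 0 ≤ t := map_nonneg_her φ (CFC.sqrt_nonneg k)
  have htt : t * t = k' := by
    have h1 : (⟨k, hkh⟩ : her h hh) = ⟨CFC.sqrt k, hs⟩ * ⟨CFC.sqrt k, hs⟩ :=
      Subtype.ext (CFC.sqrt_mul_sqrt_self k hk).symm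
    rw [← e, h1, map_mul]
    rfl
  have htm : t ∈ her k' hk' := by
    rw [← CFC.sqrt_unique htt ht0]
    exact sqrt_mem_her hk' self_mem_her
  have hrange : ∀ z : D, ∀ hz : k * z * k ∈ her h hh, (φ ⟨k * z * k, hz⟩ : D) ∈ her k' hk' := by
    intro z hz
    have hszs := mul_mul_mem_her_of_mem hs z hs
    have h1 : (⟨k * z * k, hz⟩ : her h hh) =
        ⟨CFC.sqrt k, hs⟩ * ⟨CFC.sqrt k * z * CFC.sqrt k, hszs⟩ * ⟨CFC.sqrt k, hs⟩ := by
      ext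
      change k * z * k = CFC.sqrt k * (CFC.sqrt k * z * CFC.sqrt k) * CFC.sqrt k
      nth_rw 1 2 [← CFC.sqrt_mul_sqrt_self k hk]
      simp only [mul_assoc]
    rw [h1, map_mul, map_mul]
    exact mul_mul_mem_her_of_mem htm _ htm
  have hx' : x ∈ closure (Set.range fun z => k * z * k) := by
    rw [← coe_her k hk]; exact hx
  obtain ⟨s, hsr, hsx⟩ := mem_closure_iff_seq_limit.1 hx'
  have hsm : ∀ n, s n ∈ her h hh := fun n => by
    obtain ⟨z, hz⟩ := hsr n
    rw [← hz]
    exact mul_mul_mem_her_of_mem hkh z hkh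
  have hlim : Tendsto (fun n => (⟨s n, hsm n⟩ : her h hh)) atTop (𝓝 ⟨x, hxh⟩) :=
    tendsto_subtype_rng.2 hsx
  have hcont : Continuous fun y : her h hh => (φ y : D) :=
    continuous_subtype_val.comp (AddMonoidHomClass.isometry_of_norm φ
      (StarAlgEquiv.norm_map φ)).continuous
  refine (isClosed_her k' hk').mem_of_tendsto ((hcont.tendsto _).comp hlim)
    (Eventually.of_forall fun n => ?_)
  obtain ⟨z, hz⟩ := hsr n
  have h2 : (⟨s n, hsm n⟩ : her h hh) = ⟨k * z * k, by rw [show k * z * k = s n from hz]; exact hsm n⟩ :=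
    Subtype.ext hz.symm
  change (φ ⟨s n, hsm n⟩ : D) ∈ her k' hk'
  rw [h2]
  exact hrange z _

/-- An isomorphism between hereditary subalgebras restricts to smaller hereditary subalgebras. -/
noncomputable def restrictHer (φ : her h hh ≃⋆ₐ[ℂ] her h' hh') (hkh : k ∈ her h hh)
    (hkh' : k' ∈ her h' hh') (e : φ ⟨k, hkh⟩ = ⟨k', hkh'⟩) :
    her k hk ≃⋆ₐ[ℂ] her k' hk' where
  toFun x := ⟨φ ⟨x, her_le_her hkh x.2⟩, map_mem_her φ hkh (by rw [e]) x.2 _⟩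
  invFun x := ⟨φ.symm ⟨x, her_le_her hkh' x.2⟩,
    map_mem_her φ.symm hkh' (by rw [← e, φ.symm_apply_apply]) x.2 _⟩
  left_inv x := by simp
  right_inv x := by simp
  map_mul' x y := by
    ext
    change (φ (⟨x, her_le_her hkh x.2⟩ * ⟨y, her_le_her hkh y.2⟩) : D) = _
    rw [map_mul]; rfl
  map_add' x y := by
    ext
    change (φ (⟨x, her_le_her hkh x.2⟩ + ⟨y, her_le_her hkh y.2⟩) : D) = _
    rw [map_add]; rfl
  map_star' x := by
    ext
    change (φ (star ⟨x, her_le_her hkh x.2⟩) : D) = _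
    rw [map_star]; rfl
  map_smul' c x := by
    ext
    change (φ (c • ⟨x, her_le_her hkh x.2⟩) : D) = _
    rw [_root_.map_smul]; rfl

lemma restrictHer_apply (φ : her h hh ≃⋆ₐ[ℂ] her h' hh') (hkh : k ∈ her h hh)
    (hkh' : k' ∈ her h' hh') (e : φ ⟨k, hkh⟩ = ⟨k', hkh'⟩) (x : her k hk) :
    (restrictHer (hk := hk) (hk' := hk') φ hkh hkh' e x : D) =
      φ ⟨x, her_le_her hkh x.2⟩ := rfl

lemma mul_eq_self_of_mem_her {a : D} (ha : a * h = h) {x : D} (hx : x ∈ her h hh) : a * x = x := by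
  have hx' : x ∈ closure (Set.range fun z => h * z * h) := by
    rw [← coe_her h hh]; exact hx
  refine closure_minimal (t := {x | a * x = x}) ?_ (isClosed_eq (by fun_prop) continuous_id) hx'
  rintro _ ⟨z, rfl⟩
  change a * (h * z * h) = h * z * h
  rw [← mul_assoc, ← mul_assoc, ha]

lemma mul_eq_self_of_mem_her' {a : D} (ha : h * a = h) {x : D} (hx : x ∈ her h hh) : x * a = x := by
  have h1 : star a * h = h := by
    have := congrArg star ha
    rwa [star_mul, (IsSelfAdjoint.of_nonneg hh).star_eq] at this
  have h2 := mul_eq_self_of_mem_her h1 (star_mem hx)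
  have h3 := congrArg star h2
  rwa [star_mul, star_star, star_star] at h3

variable {w p : D} (hp : 0 ≤ p) (hw : star w * w * p = p)

include hp hw in
lemma mul_star_mul_eq_self : p * (star w * w) = p := by
  have := congrArg star hw
  simpa only [star_mul, star_star, (IsSelfAdjoint.of_nonneg hp).star_eq] using this

include hw in
lemma conj_mem_her (hq : 0 ≤ w * p * star w) {x : D} (hx : x ∈ her p hp) :
    w * x * star w ∈ her (w * p * star w) hq := by
  have hx' : x ∈ closure (Set.range fun z => p * z * p) := by
    rw [← coe_her p hp]; exact hx
  rw [← SetLike.mem_coe, ← (isClosed_her _ hq).closure_eq]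
  refine map_mem_closure (f := fun x => w * x * star w) (by fun_prop) hx' ?_
  rintro _ ⟨z, rfl⟩
  -- Both outer copies of `p` absorb `w⋆ w`, which makes room for `w p w⋆` on either side.
  have h1 : w * (p * z * p) * star w =
      (w * p * star w) * (w * z * star w) * (w * p * star w) := by
    nth_rw 1 [← mul_star_mul_eq_self hp hw]
    nth_rw 2 [← hw]
    simp only [mul_assoc]
  change w * (p * z * p) * star w ∈ her _ hq
  rw [h1]
  exact mul_mul_mem_her _

include hw in
lemma star_conj_mem_her (hq : 0 ≤ w * p * star w) {y : D}
    (hy : y ∈ her (w * p * star w) hq) : star w * y * w ∈ her p hp := by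
  have hy' : y ∈ closure (Set.range fun z => (w * p * star w) * z * (w * p * star w)) := by
    rw [← coe_her _ hq]; exact hy
  rw [← SetLike.mem_coe, ← (isClosed_her p hp).closure_eq]
  refine map_mem_closure (f := fun y => star w * y * w) (by fun_prop) hy' ?_
  rintro _ ⟨z, rfl⟩
  have h1 : star w * (w * p * star w * z * (w * p * star w)) * w =
      (star w * w * p) * (star w * z * w) * (p * (star w * w)) := by
    simp only [mul_assoc]
  change star w * (w * p * star w * z * (w * p * star w)) * w ∈ her p hp
  rw [h1, hw, mul_star_mul_eq_self hp hw]
  exact mul_mul_mem_her _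

/-- If `star w * w` is a unit for `p`, then conjugation by `w` is an isomorphism from the
hereditary subalgebra generated by `p` to the one generated by `w p w⋆`. -/
noncomputable def conjHer (hq : 0 ≤ w * p * star w) :
    her p hp ≃⋆ₐ[ℂ] her (w * p * star w) hq where
  toFun x := ⟨w * x * star w, conj_mem_her hp hw hq x.2⟩
  invFun y := ⟨star w * y * w, star_conj_mem_her hp hw hq y.2⟩
  left_inv x := by
    ext
    change star w * (w * x * star w) * w = x
    calc star w * (w * x * star w) * w = (star w * w * x) * (star w * w) := by
          simp only [mul_assoc]
      _ = x := by
        rw [mul_eq_self_of_mem_her hw x.2,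
          mul_eq_self_of_mem_her' (mul_star_mul_eq_self hp hw) x.2]
  right_inv y := by
    ext
    change w * (star w * y * w) * star w = y
    have h1 : w * star w * (w * p * star w) = w * p * star w := by
      calc w * star w * (w * p * star w) = w * (star w * w * p) * star w := by
            simp only [mul_assoc]
        _ = _ := by rw [hw]
    have h2 : (w * p * star w) * (w * star w) = w * p * star w := by
      calc (w * p * star w) * (w * star w) = w * (p * (star w * w)) * star w := by
            simp only [mul_assoc]
        _ = _ := by rw [mul_star_mul_eq_self hp hw]
    calc w * (star w * y * w) * star w = (w * star w * y) * (w * star w) := by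
          simp only [mul_assoc]
      _ = y := by
        rw [mul_eq_self_of_mem_her h1 y.2, mul_eq_self_of_mem_her' h2 y.2]
  map_mul' x y := by
    ext
    change w * (x * y) * star w = (w * x * star w) * (w * y * star w)
    nth_rw 1 [← mul_eq_self_of_mem_her hw y.2]
    simp only [mul_assoc]
  map_add' x y := by
    ext
    change w * (x + y) * star w = w * x * star w + w * y * star w
    rw [mul_add, add_mul]
  map_star' x := by
    ext
    change w * star (x : D) * star w = star (w * x * star w)
    simp only [star_mul, star_star, mul_assoc]
  map_smul' c x := by
    ext
    change w * (c • (x : D)) * star w = c • (w * x * star w)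
    rw [mul_smul_comm, smul_mul_assoc]

lemma conjHer_apply (hq : 0 ≤ w * p * star w) (x : her p hp) :
    (conjHer hp hw hq x : D) = w * x * star w := rfl

/-- For `x ≠ 0` there are `g` and `0 ≠ p = f(x⋆x) ≥ 0` such that `w = x g` is isometric on `p`. -/
lemma exists_isometric_on {x : D} (hx : x ≠ 0) :
    ∃ (f : ℝ → ℝ) (g : D), 0 ≤ cfcₙ f (star x * x) ∧ cfcₙ f (star x * x) ≠ 0 ∧
      star (x * g) * (x * g) * cfcₙ f (star x * x) = cfcₙ f (star x * x) := by
  set m := star x * x with hm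
  have hm0 : 0 ≤ m := star_mul_self_nonneg x
  have hmne : m ≠ 0 := fun h => hx ((CStarRing.star_mul_self_eq_zero_iff x).1 h)
  set ε : ℝ := ‖m‖ / 2 with hε
  have hmpos : 0 < ‖m‖ := norm_pos_iff.2 hmne
  have hε0 : 0 < ε := by positivity
  -- The function `g` is `t^(-1/2)` for `t ≥ ε`, cut off below to be continuous with `g 0 = 0`;
  -- hence `w⋆ w = g(m) m g(m)` acts as `1` where `f` is nonzero. As `‖m‖` lies in the quasispectrum
  -- and `f ‖m‖ = ‖m‖ / 2 > 0`, `f(m) ≠ 0`.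
  obtain ⟨f, hf⟩ : ∃ f : ℝ → ℝ, f = fun t => max (t - ε) 0 := ⟨_, rfl⟩
  obtain ⟨g, hg⟩ : ∃ g : ℝ → ℝ, g = fun t => t / (max t ε * √(max t ε)) := ⟨_, rfl⟩
  have hpos : ∀ t, 0 < max t ε := fun t => lt_max_of_lt_right hε0
  have hfc : Continuous f := by rw [hf]; fun_prop
  have hgc : Continuous g := by
    rw [hg]
    refine continuous_id.div (by fun_prop) fun t => ?_
    have h1 := hpos t
    have h2 := Real.sqrt_pos.2 h1
    positivity
  have hf0 : f 0 = 0 := by simp [hf, hε0.le]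
  have hg0 : g 0 = 0 := by simp [hg]
  have hG : IsSelfAdjoint (cfcₙ g m) := cfcₙ_predicate g m
  refine ⟨f, cfcₙ g m, cfcₙ_nonneg fun t _ => by rw [hf]; exact le_max_right _ _, ?_, ?_⟩
  · obtain ⟨t, ht, htm⟩ :=
      (NonUnitalIsometricContinuousFunctionalCalculus.isGreatest_norm_quasispectrum
        (𝕜 := ℝ) m (IsSelfAdjoint.of_nonneg hm0)).1
    have ht0 := quasispectrum_nonneg_of_nonneg m hm0 t ht
    have htm' : t = ‖m‖ := (Real.norm_of_nonneg ht0).symm.trans htm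
    intro h0
    have h1 := norm_apply_le_norm_cfcₙ f m ht hfc.continuousOn hf0
    rw [h0, norm_zero, norm_le_zero_iff] at h1
    simp only [hf, htm'] at h1
    have : ‖m‖ - ε ≤ 0 := by rw [← h1]; exact le_max_left _ _
    linarith
  · have h1 : star (x * cfcₙ g m) * (x * cfcₙ g m) * cfcₙ f m =
        cfcₙ g m * cfcₙ (fun t : ℝ => t) m * cfcₙ g m * cfcₙ f m := by
      rw [cfcₙ_id' ℝ m, star_mul, hG.star_eq, hm]
      simp only [mul_assoc]
    have c1 : Continuous fun t => g t * t := hgc.mul continuous_id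
    have c2 : Continuous fun t => g t * t * g t := c1.mul hgc
    have z1 : g 0 * 0 = 0 := mul_zero _
    have z2 : g 0 * 0 * g 0 = 0 := by rw [hg0, mul_zero]
    rw [h1, ← cfcₙ_mul g (fun t => t) m hgc.continuousOn hg0 continuousOn_id rfl,
      ← cfcₙ_mul (fun t => g t * t) g m c1.continuousOn z1 hgc.continuousOn hg0,
      ← cfcₙ_mul (fun t => g t * t * g t) f m c2.continuousOn z2 hfc.continuousOn hf0]
    refine cfcₙ_congr fun t ht => ?_
    have ht0 := quasispectrum_nonneg_of_nonneg m hm0 t ht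
    by_cases hte : t ≤ ε
    · simp [hf, hte]
    · push Not at hte
      have hgt : g t = (√t)⁻¹ := by
        simp only [hg, max_eq_left hte.le]
        have : t ≠ 0 := (hε0.trans hte).ne'
        field_simp
      have hsq : (√t)⁻¹ * t * (√t)⁻¹ = 1 := by
        have h3 : √t ≠ 0 := (Real.sqrt_pos.2 (hε0.trans hte)).ne'
        field_simp
        exact (Real.sq_sqrt ht0).symm
      simp only [hgt, hsq, one_mul]

end HereditaryIso

/-! ### Roots of `h` as an approximate unit -/

section Dimension

variable {D : Type u} [NonUnitalCStarAlgebra D] [PartialOrder D] [StarOrderedRing D]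

lemma tendsto_nnrpow_mul_self {h : D} (hh : 0 ≤ h) :
    Tendsto (fun n : ℕ => h ^ (1 / ((n : ℝ≥0) + 1)) * h) atTop (𝓝 h) := by
  -- The product is `h ^ (1 / (n + 1) + 1)`. With exponents in `[1, 2]`, away from `0`, the power is
  -- jointly continuous even at base `0`, so convergence is uniform on the quasispectrum.
  have hr : Tendsto (fun n : ℕ => 1 / ((n : ℝ≥0) + 1) + 1) atTop (𝓝[Set.Icc 1 2] 1) := by
    refine tendsto_nhdsWithin_iff.2 ⟨?_, Eventually.of_forall fun n => ⟨?_, ?_⟩⟩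
    · simpa using (NNReal.tendsto_coe.1 (by
        simpa using tendsto_one_div_add_atTop_nhds_zero_nat (𝕜 := ℝ)) :
          Tendsto (fun n : ℕ => 1 / ((n : ℝ≥0) + 1)) atTop (𝓝 0)).add_const 1
    · simp
    · rw [← one_add_one_eq_two]
      gcongr
      rw [div_le_one (by positivity)]
      simp
  have hu : TendstoUniformlyOn (fun r t : ℝ≥0 => NNReal.nnrpow t r) (NNReal.nnrpow · 1)
      (𝓝[Set.Icc 1 2] 1) (quasispectrum ℝ≥0 h) := by
    refine UniformContinuousOn.tendstoUniformlyOn (F := fun r t : ℝ≥0 => NNReal.nnrpow t r) ?_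
      ⟨le_rfl, one_le_two⟩
    refine (isCompact_Icc.prod
      (NonUnitalContinuousFunctionalCalculus.isCompact_quasispectrum h)).uniformContinuousOn_of_continuous ?_
    rintro ⟨r, t⟩ ⟨hr, -⟩
    refine ContinuousAt.continuousWithinAt ?_
    have h1 : ContinuousAt (fun p : ℝ≥0 × ℝ≥0 => NNReal.nnrpow p.2 p.1) (r, t) := by
      have := NNReal.continuousAt_rpow (x := t) (y := (r : ℝ))
        (Or.inr (lt_of_lt_of_le one_pos (by exact_mod_cast hr.1)))
      exact ContinuousAt.comp (f := fun p : ℝ≥0 × ℝ≥0 => (p.2, (p.1 : ℝ))) (x := (r, t)) this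
        (by fun_prop)
    exact h1
  have h1 := (tendsto_cfcₙ_fun (a := h) hu
    (Eventually.of_forall fun r => (NNReal.continuous_nnrpow_const r).continuousOn)
    (by
      filter_upwards [self_mem_nhdsWithin] with r hr
      exact NNReal.zero_rpow (by
        have : (0 : ℝ≥0) < r := lt_of_lt_of_le one_pos hr.1
        exact_mod_cast this.ne'))).comp hr
  have h2 : cfcₙ (NNReal.nnrpow · 1) h = h := by
    rw [← CFC.nnrpow_def, CFC.nnrpow_one h]
  rw [h2] at h1
  refine h1.congr fun n => ?_
  change h ^ (1 / ((n : ℝ≥0) + 1) + 1) = _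
  rw [CFC.nnrpow_add (by positivity) one_pos, CFC.nnrpow_one h]

lemma norm_nnrpow_le {h : D} (hh : 0 ≤ h) (n : ℕ) :
    ‖h ^ (1 / ((n : ℝ≥0) + 1))‖ ≤ max 1 ‖h‖ := by
  rw [CFC.norm_nnrpow h (by positivity)]
  have h1 : (((1 / ((n : ℝ≥0) + 1) : ℝ≥0)) : ℝ) ≤ 1 := by
    have : 1 / ((n : ℝ≥0) + 1) ≤ 1 := by
      rw [div_le_one (by positivity)]
      simp
    exact_mod_cast this
  calc ‖h‖ ^ ((1 / ((n : ℝ≥0) + 1) : ℝ≥0) : ℝ)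
      ≤ (max 1 ‖h‖) ^ ((1 / ((n : ℝ≥0) + 1) : ℝ≥0) : ℝ) :=
        Real.rpow_le_rpow (norm_nonneg _) (le_max_right _ _) (NNReal.coe_nonneg _)
    _ ≤ (max 1 ‖h‖) ^ (1 : ℝ) := Real.rpow_le_rpow_of_exponent_le (le_max_left _ _) h1
    _ = max 1 ‖h‖ := Real.rpow_one _

lemma tendsto_nnrpow_mul_of_mem_her {h : D} {hh : 0 ≤ h} {y : D} (hy : y ∈ her h hh) :
    Tendsto (fun n : ℕ => h ^ (1 / ((n : ℝ≥0) + 1)) * y) atTop (𝓝 y) := by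
  have hy' : y ∈ closure (Set.range fun z => h * z * h) := by
    rw [← coe_her h hh]; exact hy
  refine tendsto_mul_of_mem_closure (norm_nnrpow_le hh) ?_ hy'
  rintro _ ⟨z, rfl⟩
  simpa only [mul_assoc] using (tendsto_nnrpow_mul_self hh).mul_const (z * h)

end Dimension

/-! ### The dimension function and the group of scaling factors -/

section DimStab

variable {A : Type u} [NonUnitalCStarAlgebra A] [PartialOrder A] [StarOrderedRing A]

/-- With `r = h ^ (1 / (n + 1))`, `√x r √x → x` and `τ̂ (√x r √x) = τ̂ (√r x √r) ≤ τ̂ r`; lower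
semicontinuity concludes. -/
lemma hat_le_dim (hσ : IsSigmaUnital A) {τ : PosTrace A} (hl : τ.IsLSC) {h : Stab A}
    {hh : 0 ≤ h} {x : Stab A} (hx : x ∈ her h hh) (hx0 : 0 ≤ x) (hx1 : ‖x‖ ≤ 1) :
    τ.hat x ≤ τ.dim h := by
  set T := hatTrace hσ τ hl
  have hT : ∀ y, T.toFun y = τ.hat y := fun y => rfl
  refine le_of_forall_gt_imp_ge_of_dense fun c hc => ?_
  have hev := eventually_lt_of_limsup_lt hc
  have hs := sqrt_mem_her hx0 hx
  have hlim : Tendsto (fun n : ℕ => CFC.sqrt x * (h ^ (1 / ((n : ℝ≥0) + 1)) * CFC.sqrt x)) atTop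
      (𝓝 x) := by
    have := (tendsto_nnrpow_mul_of_mem_her hs).const_mul (CFC.sqrt x)
    rwa [CFC.sqrt_mul_sqrt_self x hx0] at this
  refine (hatTrace_isLSC hσ τ hl).le_of_tendsto hlim (fun n => ?_) ?_
  · have := star_left_conjugate_nonneg (CFC.nnrpow_nonneg (a := h) (x := 1 / ((n : ℝ≥0) + 1)))
      (CFC.sqrt x)
    rwa [star_sqrt, mul_assoc] at this
  · filter_upwards [hev] with n hn
    refine le_trans ?_ hn.le
    set r := h ^ (1 / ((n : ℝ≥0) + 1))
    have hr0 : 0 ≤ r := CFC.nnrpow_nonneg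
    have e1 : CFC.sqrt x * (r * CFC.sqrt x) =
        star (CFC.sqrt r * CFC.sqrt x) * (CFC.sqrt r * CFC.sqrt x) := by
      rw [star_mul, star_sqrt, star_sqrt]
      nth_rw 1 [← CFC.sqrt_mul_sqrt_self r hr0]
      simp only [mul_assoc]
    have e2 : CFC.sqrt r * CFC.sqrt x * star (CFC.sqrt r * CFC.sqrt x) =
        star (CFC.sqrt r) * x * CFC.sqrt r := by
      rw [star_mul, star_sqrt, star_sqrt]
      nth_rw 3 [← CFC.sqrt_mul_sqrt_self x hx0]
      simp only [mul_assoc]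
    rw [e1, T.map_star_mul_self, e2, ← hT]
    refine PosTrace.mono (star_left_conjugate_nonneg hx0 _) ?_
    refine (star_mul_mul_le_of_norm_le_one hx0 hx1 _).trans_eq ?_
    rw [star_sqrt, CFC.sqrt_mul_sqrt_self r hr0]

/-- The roots of `h`, divided by their norms, are admissible `x`; the norms `‖h‖ ^ (1 / (n + 1))`
tend to `1`. -/
lemma dim_le_of_forall (hσ : IsSigmaUnital A) {τ : PosTrace A} (hl : τ.IsLSC) {h : Stab A}
    {hh : 0 ≤ h} (h0 : h ≠ 0) {M : ℝ≥0∞}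
    (hM : ∀ x ∈ her h hh, 0 ≤ x → ‖x‖ ≤ 1 → τ.hat x ≤ M) : τ.dim h ≤ M := by
  have hpos : 0 < ‖h‖ := norm_pos_iff.2 h0
  set T := hatTrace hσ τ hl
  have hT : ∀ y, T.toFun y = τ.hat y := fun y => rfl
  have hb : ∀ n : ℕ, τ.hat (h ^ (1 / ((n : ℝ≥0) + 1))) ≤
      ENNReal.ofReal (‖h‖ ^ (1 / ((n : ℝ) + 1))) * M := fun n => by
    set r := h ^ (1 / ((n : ℝ≥0) + 1)) with hr
    have hr0 : 0 ≤ r := CFC.nnrpow_nonneg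
    have hrn : ‖r‖ = ‖h‖ ^ (1 / ((n : ℝ) + 1)) := by
      rw [hr, CFC.norm_nnrpow h (by positivity)]
      norm_cast
    have hrpos : 0 < ‖r‖ := by rw [hrn]; positivity
    have hx0 : 0 ≤ ‖r‖⁻¹ • r := smul_nonneg (by positivity) hr0
    have e : r = ‖r‖ • (‖r‖⁻¹ • r) := by rw [smul_smul, mul_inv_cancel₀ hrpos.ne', one_smul]
    have hmem : ‖r‖⁻¹ • r ∈ her h hh := by
      rw [← Complex.coe_smul]
      exact SMulMemClass.smul_mem _ (nnrpow_mem_her _ hh self_mem_her)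
    have h1 := hM _ hmem hx0 (by
      rw [norm_smul, norm_inv, norm_norm, inv_mul_cancel₀ hrpos.ne'])
    rw [← hrn]
    rw [e, ← hT, T.map_smul_real (norm_nonneg _) hx0, hT, ← e]
    gcongr
  have ht : Tendsto (fun n : ℕ => ENNReal.ofReal (‖h‖ ^ (1 / ((n : ℝ) + 1))) * M) atTop
      (𝓝 (1 * M)) := by
    refine ENNReal.Tendsto.mul_const ?_ (Or.inl one_ne_zero)
    have h1 := ((Real.continuous_const_rpow hpos.ne').tendsto 0).comp
      (tendsto_one_div_add_atTop_nhds_zero_nat (𝕜 := ℝ))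
    rw [Real.rpow_zero] at h1
    simpa using ENNReal.tendsto_ofReal h1
  rw [one_mul] at ht
  calc τ.dim h ≤ limsup (fun n : ℕ => ENNReal.ofReal (‖h‖ ^ (1 / ((n : ℝ) + 1))) * M) atTop :=
        limsup_le_limsup (Eventually.of_forall hb)
    _ = M := ht.limsup_eq

variable {h₁ h₂ : Stab A} {p₁ : 0 ≤ h₁} {p₂ : 0 ≤ h₂}

/-- `φ` multiplies `τ̂` by `c`. -/
def ScalesBy (τ : PosTrace A) (φ : her h₁ p₁ ≃⋆ₐ[ℂ] her h₂ p₂) (c : ℝ≥0) : Prop :=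
  ∀ x : her h₁ p₁, 0 ≤ (x : Stab A) → τ.hat (φ x : Stab A) = c * τ.hat (x : Stab A)

lemma ScalesBy.symm {τ : PosTrace A} {φ : her h₁ p₁ ≃⋆ₐ[ℂ] her h₂ p₂} {c : ℝ≥0} (hc : c ≠ 0)
    (hφ : ScalesBy τ φ c) : ScalesBy τ φ.symm c⁻¹ := fun y hy => by
  have h1 := hφ (φ.symm y) (map_nonneg_her φ.symm hy)
  rw [φ.apply_symm_apply] at h1
  rw [h1, ← mul_assoc, ← ENNReal.coe_mul, inv_mul_cancel₀ hc, ENNReal.coe_one, one_mul]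

lemma ScalesBy.trans {τ : PosTrace A} {h₃ : Stab A} {p₃ : 0 ≤ h₃}
    {φ : her h₁ p₁ ≃⋆ₐ[ℂ] her h₂ p₂} {ψ : her h₂ p₂ ≃⋆ₐ[ℂ] her h₃ p₃} {c d : ℝ≥0}
    (hφ : ScalesBy τ φ c) (hψ : ScalesBy τ ψ d) : ScalesBy τ (φ.trans ψ) (c * d) := fun x hx => by
  rw [StarAlgEquiv.trans_apply, hψ _ (map_nonneg_her φ hx), hφ x hx, ENNReal.coe_mul]
  ring

lemma ScalesBy.dim_le (hσ : IsSigmaUnital A) {τ : PosTrace A} (hl : τ.IsLSC) (n₂ : h₂ ≠ 0)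
    {φ : her h₁ p₁ ≃⋆ₐ[ℂ] her h₂ p₂} {c : ℝ≥0} (hφ : ScalesBy τ φ c) :
    τ.dim h₂ ≤ c * τ.dim h₁ := by
  refine dim_le_of_forall hσ hl (hh := p₂) n₂ fun y hy hy0 hy1 => ?_
  have hx0 : 0 ≤ (φ.symm ⟨y, hy⟩ : Stab A) := map_nonneg_her φ.symm hy0
  have h1 := hφ (φ.symm ⟨y, hy⟩) hx0
  rw [φ.apply_symm_apply] at h1
  rw [show τ.hat y = τ.hat ((⟨y, hy⟩ : her h₂ p₂) : Stab A) from rfl, h1]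
  gcongr
  refine hat_le_dim hσ hl (φ.symm ⟨y, hy⟩).2 hx0 ?_
  have := StarAlgEquiv.norm_map φ.symm ⟨y, hy⟩
  exact this.trans_le hy1

lemma ScalesBy.dim_eq (hσ : IsSigmaUnital A) {τ : PosTrace A} (hl : τ.IsLSC) (n₁ : h₁ ≠ 0)
    (n₂ : h₂ ≠ 0) {φ : her h₁ p₁ ≃⋆ₐ[ℂ] her h₂ p₂} {c : ℝ≥0} (hc : c ≠ 0)
    (hφ : ScalesBy τ φ c) : τ.dim h₂ = c * τ.dim h₁ := by
  refine le_antisymm (hφ.dim_le hσ hl n₂) ?_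
  calc (c : ℝ≥0∞) * τ.dim h₁ ≤ c * ((c⁻¹ : ℝ≥0) * τ.dim h₂) := by
        gcongr
        exact (hφ.symm hc).dim_le hσ hl n₁
    _ = τ.dim h₂ := by
        rw [← mul_assoc, ← ENNReal.coe_mul, mul_inv_cancel₀ hc, ENNReal.coe_one, one_mul]

lemma dim_mono_of_mem (hσ : IsSigmaUnital A) {τ : PosTrace A} (hl : τ.IsLSC) (n₁ : h₁ ≠ 0)
    (p₁ : 0 ≤ h₁) (hmem : h₁ ∈ her h₂ p₂) : τ.dim h₁ ≤ τ.dim h₂ :=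
  dim_le_of_forall hσ hl (hh := p₁) n₁ fun _ hx hx0 hx1 =>
    hat_le_dim hσ hl (her_le_her hmem hx) hx0 hx1

lemma dim_ne_zero (hA : IsSimple A) (hσ : IsSigmaUnital A) {τ : PosTrace A}
    (hτ : τ.IsUniqueTrace) (p₁ : 0 ≤ h₁) (n₁ : h₁ ≠ 0) : τ.dim h₁ ≠ 0 := by
  intro h0
  have hpos : 0 < ‖h₁‖ := norm_pos_iff.2 n₁
  set T := hatTrace hσ τ hτ.2.1
  have hT : ∀ y, T.toFun y = τ.hat y := fun y => rfl
  have hx0 : 0 ≤ ‖h₁‖⁻¹ • h₁ := smul_nonneg (by positivity) p₁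
  have hmem : ‖h₁‖⁻¹ • h₁ ∈ her h₁ p₁ := by
    rw [← Complex.coe_smul]
    exact SMulMemClass.smul_mem _ self_mem_her
  have h1 := hat_le_dim hσ hτ.2.1 hmem hx0 (by
    rw [norm_smul, norm_inv, norm_norm, inv_mul_cancel₀ hpos.ne'])
  rw [h0, nonpos_iff_eq_zero] at h1
  have h2 := hat_faithful hA hσ hτ (x := CFC.sqrt (‖h₁‖⁻¹ • h₁)) (by
    rwa [star_sqrt, CFC.sqrt_mul_sqrt_self _ hx0])
  rw [CFC.sqrt_eq_zero_iff _ hx0, smul_eq_zero] at h2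
  rcases h2 with h2 | h2
  · exact hpos.ne' (inv_eq_zero.1 h2)
  · exact n₁ h2

/-- Nonzero hereditary subalgebras contain nonzero hereditary subalgebras that are isomorphic
in a trace preserving way. -/
lemma exists_iso_of_ne_zero (hA : IsSimple A) (hσ : IsSigmaUnital A) {τ : PosTrace A}
    (hl : τ.IsLSC) (p₁ : 0 ≤ h₁) (p₂ : 0 ≤ h₂) (n₁ : h₁ ≠ 0) (n₂ : h₂ ≠ 0) :
    ∃ (p q : Stab A) (hp : 0 ≤ p) (hq : 0 ≤ q), p ≠ 0 ∧ q ≠ 0 ∧ p ∈ her h₁ p₁ ∧ q ∈ her h₂ p₂ ∧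
      ∃ θ : her p hp ≃⋆ₐ[ℂ] her q hq, ScalesBy τ θ 1 := by
  -- For `x = h₂ y h₁`, `x⋆ x` lies in `her h₁` and `x x⋆` in `her h₂`; `w = x g` replaces the polar
  -- part of `x`.
  obtain ⟨y, hy⟩ := exists_mul_mul_ne_zero (isSimple_stab hA hσ) n₂ n₁
  obtain ⟨f, g, hp, hp0, hw⟩ := exists_isometric_on hy
  set x := h₂ * y * h₁ with hx
  set p := cfcₙ f (star x * x)
  set w := x * g with hwdef
  have hq : 0 ≤ w * p * star w := star_right_conjugate_nonneg hp w
  have hs₁ := (IsSelfAdjoint.of_nonneg p₁).star_eq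
  have hs₂ := (IsSelfAdjoint.of_nonneg p₂).star_eq
  refine ⟨p, w * p * star w, hp, hq, hp0, fun h0 => hp0 ?_, ?_, ?_, conjHer hp hw hq,
    fun a ha => ?_⟩
  · calc p = (star w * w * p) * (star w * w) := by rw [hw, mul_star_mul_eq_self hp hw]
      _ = star w * (w * p * star w) * w := by simp only [mul_assoc]
      _ = 0 := by rw [h0, mul_zero, zero_mul]
  · refine cfcn_mem_her f ?_
    have := mul_mul_mem_her (h := h₁) (hh := p₁) (star y * h₂ * h₂ * y)
    rw [hx, star_mul, star_mul, hs₁, hs₂]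
    simpa only [mul_assoc] using this
  · have := mul_mul_mem_her (h := h₂) (hh := p₂) (y * h₁ * g * p * star g * h₁ * star y)
    rw [hwdef, hx]
    simp only [star_mul, hs₁, hs₂]
    simpa only [mul_assoc] using this
  · set T := hatTrace hσ τ hl
    have hT : ∀ y, T.toFun y = τ.hat y := fun y => rfl
    set s := CFC.sqrt (a : Stab A) with hs
    have hsm : s ∈ her p hp := sqrt_mem_her ha a.2
    have hss : star s * s = a := by rw [hs, star_sqrt, CFC.sqrt_mul_sqrt_self _ ha]
    have hss' : s * star s = a := by rw [hs, star_sqrt, CFC.sqrt_mul_sqrt_self _ ha]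
    -- The trace is preserved because `(ws)(ws)⋆ = w a w⋆` while `(ws)⋆ (ws) = a`, as `w⋆ w` fixes
    -- `s`.
    have e1 : w * a * star w = w * s * star (w * s) := by
      rw [← hss', star_mul w s]
      simp only [mul_assoc]
    have e2 : star (w * s) * (w * s) = a := by
      rw [star_mul]
      calc star s * star w * (w * s) = star s * (star w * w * s) := by simp only [mul_assoc]
        _ = a := by rw [mul_eq_self_of_mem_her hw hsm, hss]
    rw [conjHer_apply, e1, ← hT, ← T.map_star_mul_self, e2, hT, ENNReal.coe_one, one_mul]

/-- If `w⋆ w` has finite trace and is a unit for `p`, every positive contraction `x` in `her p`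
satisfies `x = w⋆ w x w⋆ w ≤ (w⋆ w)²`, which bounds its trace uniformly. -/
lemma exists_dim_lt_top (hA : IsSimple A) (hσ : IsSigmaUnital A) {τ : PosTrace A}
    (hτ : τ.IsUniqueTrace) : ∃ p : Stab A, 0 ≤ p ∧ p ≠ 0 ∧ τ.dim p < ∞ := by
  obtain ⟨h, h0⟩ := @exists_ne _ (isSimple_stab hA hσ).1 (0 : Stab A)
  obtain ⟨y, -, hy0, -, -, hyf⟩ := exists_finite_mem_her hA hσ hτ.1 hτ.2.1
    (star_mul_self_nonneg h) (fun h1 => h0 ((CStarRing.star_mul_self_eq_zero_iff h).1 h1))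
  obtain ⟨f, g, hp, hp0, hw⟩ := exists_isometric_on hy0
  set p := cfcₙ f (star y * y)
  set w := y * g with hwdef
  set T := hatTrace hσ τ hτ.2.1
  have hT : ∀ y, T.toFun y = τ.hat y := fun y => rfl
  have hwf : T.toFun (star w * w) < ∞ := (PosTrace.apply_star_mul_right_le _ _).trans_lt
    (ENNReal.mul_lt_top (by simp) hyf)
  refine ⟨p, hp, hp0, lt_of_le_of_lt (dim_le_of_forall hσ hτ.2.1 (hh := hp) hp0
    (M := ENNReal.ofReal (‖w‖ ^ 2) * T.toFun (star w * w)) fun x hx hx0 hx1 => ?_)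
    (ENNReal.mul_lt_top (by simp) hwf)⟩
  have e : x = star (star w * w) * x * (star w * w) := by
    rw [star_mul, star_star, mul_eq_self_of_mem_her hw hx,
      mul_eq_self_of_mem_her' (mul_star_mul_eq_self hp hw) hx]
  rw [← hT, e]
  refine (PosTrace.mono (star_left_conjugate_nonneg hx0 _)
    (star_mul_mul_le_of_norm_le_one hx0 hx1 _)).trans ?_
  have := PosTrace.apply_star_mul_left_le (τ := T) (star w) w
  rwa [norm_star] at this

lemma ScalesBy.restrictHer {τ : PosTrace A} {φ : her h₁ p₁ ≃⋆ₐ[ℂ] her h₂ p₂} {c : ℝ≥0}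
    (hφ : ScalesBy τ φ c) {k k' : Stab A} {hk : 0 ≤ k} {hk' : 0 ≤ k'} (hkh : k ∈ her h₁ p₁)
    (hkh' : k' ∈ her h₂ p₂) (e : φ ⟨k, hkh⟩ = ⟨k', hkh'⟩) :
    ScalesBy τ (FundGroup.restrictHer (hk := hk) (hk' := hk') φ hkh hkh' e) c := fun x hx => by
  rw [restrictHer_apply]
  exact hφ _ hx

/-- `c` is the scaling factor of an isomorphism between hereditary subalgebras, the second of
which has finite dimension. -/
def IsScale (τ : PosTrace A) (c : ℝ≥0) : Prop :=
  ∃ (h₁ h₂ : Stab A) (p₁ : 0 ≤ h₁) (p₂ : 0 ≤ h₂), h₁ ≠ 0 ∧ h₂ ≠ 0 ∧ τ.dim h₂ < ∞ ∧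
    ∃ φ : her h₁ p₁ ≃⋆ₐ[ℂ] her h₂ p₂, ScalesBy τ φ c

lemma isScale_one (hA : IsSimple A) (hσ : IsSigmaUnital A) {τ : PosTrace A}
    (hτ : τ.IsUniqueTrace) : IsScale τ 1 := by
  obtain ⟨p, hp, hp0, hpf⟩ := exists_dim_lt_top hA hσ hτ
  exact ⟨p, p, hp, hp, hp0, hp0, hpf, StarAlgEquiv.refl _ _, fun x _ => by simp⟩

lemma IsScale.inv (hσ : IsSigmaUnital A) {τ : PosTrace A} (hl : τ.IsLSC) {c : ℝ≥0} (hc : c ≠ 0)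
    (h : IsScale τ c) : IsScale τ c⁻¹ := by
  obtain ⟨h₁, h₂, p₁, p₂, n₁, n₂, hf, φ, hφ⟩ := h
  refine ⟨h₂, h₁, p₂, p₁, n₂, n₁, ?_, φ.symm, hφ.symm hc⟩
  exact ((hφ.symm hc).dim_le hσ hl n₁).trans_lt (ENNReal.mul_lt_top (by simp) hf)

/-- A trace preserving `θ` joins a piece `p` of the target of `φ` to a piece `q` of the source of
`ψ`. Pulling `p` back by `φ` and pushing `q` forward by `ψ` makes the three maps composable; the new
target lies in the old one, so its dimension stays finite. -/
lemma IsScale.mul (hA : IsSimple A) (hσ : IsSigmaUnital A) {τ : PosTrace A} (hl : τ.IsLSC)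
    {c d : ℝ≥0} (hc : IsScale τ c) (hd : IsScale τ d) : IsScale τ (c * d) := by
  obtain ⟨h₁, h₂, p₁, p₂, n₁, n₂, -, φ, hφ⟩ := hc
  obtain ⟨k₁, k₂, q₁, q₂, m₁, m₂, hf, ψ, hψ⟩ := hd
  obtain ⟨p, q, hp, hq, hp0, hq0, hpm, hqm, θ, hθ⟩ := exists_iso_of_ne_zero hA hσ hl p₂ q₁ n₂ m₁
  obtain ⟨p', hpp'⟩ : ∃ p', p' = φ.symm ⟨p, hpm⟩ := ⟨_, rfl⟩
  obtain ⟨q', hqq'⟩ : ∃ q', q' = ψ ⟨q, hqm⟩ := ⟨_, rfl⟩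
  have hp' : 0 ≤ (p' : Stab A) := by rw [hpp']; exact map_nonneg_her φ.symm hp
  have hq' : 0 ≤ (q' : Stab A) := by rw [hqq']; exact map_nonneg_her ψ hq
  have eφ : φ p' = ⟨p, hpm⟩ := by rw [hpp', φ.apply_symm_apply]
  have hp0' : (p' : Stab A) ≠ 0 := fun h => hp0 <| by
    rw [show p' = 0 from Subtype.ext h, map_zero] at eφ
    exact (congrArg Subtype.val eφ).symm
  have hq0' : (q' : Stab A) ≠ 0 := fun h => hq0 <| by
    have eψ : ψ.symm q' = ⟨q, hqm⟩ := by rw [hqq', ψ.symm_apply_apply]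
    rw [show q' = 0 from Subtype.ext h, map_zero] at eψ
    exact (congrArg Subtype.val eψ).symm
  have hφ' := hφ.restrictHer (hk := hp') (hk' := hp) p'.2 hpm eφ
  have hψ' := hψ.restrictHer (hk := hq) (hk' := hq') hqm q'.2 hqq'.symm
  have hall := (hφ'.trans hθ).trans hψ'
  rw [mul_one] at hall
  exact ⟨p', q', hp', hq', hp0', hq0',
    (dim_mono_of_mem hσ hl hq0' hq' q'.2).trans_lt hf, _, hall⟩

lemma mem_fundamentalSet_iff (hA : IsSimple A) (hσ : IsSigmaUnital A) {τ : PosTrace A}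
    (hτ : τ.IsUniqueTrace) (t : ℝ≥0∞) :
    t ∈ τ.fundamentalSet ↔ ∃ c : ℝ≥0, c ≠ 0 ∧ IsScale τ c ∧ t = c := by
  have hl := hτ.2.1
  -- The ratio has source over target, so it is the inverse of the factor of `φ`. The cancellation
  -- in `[0, ∞]` needs `d_τ h₂` nonzero and finite.
  have key : ∀ {h₁ h₂ : Stab A} {p₁ : 0 ≤ h₁} {p₂ : 0 ≤ h₂}, h₁ ≠ 0 → h₂ ≠ 0 → τ.dim h₂ < ∞ →
      ∀ {φ : her h₁ p₁ ≃⋆ₐ[ℂ] her h₂ p₂} {c : ℝ≥0}, c ≠ 0 → ScalesBy τ φ c →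
      τ.dim h₁ / τ.dim h₂ = ((c⁻¹ : ℝ≥0) : ℝ≥0∞) := by
    intro h₁ h₂ p₁ p₂ n₁ n₂ hf φ c hc hφ
    have h1 := (hφ.symm hc).dim_eq hσ hl n₂ n₁ (inv_ne_zero hc)
    rw [h1, mul_div_assoc, ENNReal.div_self (dim_ne_zero hA hσ hτ p₂ n₂) hf.ne, mul_one]
  constructor
  · rintro ⟨h₁, h₂, p₁, p₂, n₁, n₂, ⟨φ⟩, hf, rfl⟩
    obtain ⟨c, hc, hφ⟩ := exists_scaling hA hσ hτ n₁ n₂ φ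
    refine ⟨c⁻¹, inv_ne_zero hc, ?_, key n₁ n₂ hf hc hφ⟩
    exact IsScale.inv hσ hl hc ⟨h₁, h₂, p₁, p₂, n₁, n₂, hf, φ, hφ⟩
  · rintro ⟨c, hc, hs, rfl⟩
    obtain ⟨h₁, h₂, p₁, p₂, n₁, n₂, hf, φ, hφ⟩ := hs.inv hσ hl hc
    refine ⟨h₁, h₂, p₁, p₂, n₁, n₂, ⟨φ⟩, hf, ?_⟩
    rw [key n₁ n₂ hf (inv_ne_zero hc) hφ, inv_inv]

end DimStab

end FundGroup

/-! ### The fundamental group -/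

theorem theorem4p3 {A : Type*} [NonUnitalCStarAlgebra A] [PartialOrder A] [StarOrderedRing A]
    (hsimple : FundGroup.IsSimple A) (hunital : FundGroup.IsSigmaUnital A)
    (τ : FundGroup.PosTrace A) (hτ : τ.IsUniqueTrace) :
    ∃ G : Subgroup {r : ℝ // 0 < r},
      τ.fundamentalSet = (fun r : {r : ℝ // 0 < r} => ENNReal.ofReal r) '' (G : Set {r : ℝ // 0 < r}) := by
  have hne : ∀ r : {r : ℝ // 0 < r}, (r : ℝ).toNNReal ≠ 0 := fun r =>
    (Real.toNNReal_pos.2 r.2).ne'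
  refine ⟨{ carrier := {r | FundGroup.IsScale τ (r : ℝ).toNNReal}
            mul_mem' := fun {r s} hr hs => ?_
            one_mem' := ?_
            inv_mem' := fun {r} hr => ?_ }, ?_⟩
  · have := FundGroup.IsScale.mul hsimple hunital hτ.2.1 hr hs
    rwa [← Real.toNNReal_mul r.2.le] at this
  · have := FundGroup.isScale_one hsimple hunital hτ
    rwa [← Real.toNNReal_one] at this
  · have := FundGroup.IsScale.inv hunital hτ.2.1 (hne r) hr
    rwa [← Real.toNNReal_inv] at this
  · ext t
    rw [FundGroup.mem_fundamentalSet_iff hsimple hunital hτ]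
    constructor
    · rintro ⟨c, hc, hs, rfl⟩
      refine ⟨⟨c, by positivity⟩, ?_, ENNReal.ofReal_coe_nnreal⟩
      change FundGroup.IsScale τ (c : ℝ).toNNReal
      rwa [Real.toNNReal_coe]
    · rintro ⟨r, hr, rfl⟩
      exact ⟨(r : ℝ).toNNReal, hne r, hr, rfl⟩
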